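/- Let $G$ be a finite simple planar graph on $n$ vertices with girth at least $6$ (that is, every cycle of $G$ has length at least $6$; forests are included). Let $\mathcal{G}(G,5)$ be the graph whose vertices are the proper $5$-colourings $V(G)\to\{1,\dots,5\}$ of $G$, two colourings being adjacent when they differ on exactly one vertex of $G$. Then $\mathcal{G}(G,5)$ is connected, and any two $5$-colourings $\alpha,\beta$ of $G$ are joined by a walk in $\mathcal{G}(G,5)$ (a sequence of single-vertex recolourings through proper $5$-colourings) in which every vertex of $G$ is recoloured at most $6143$ times. In particular, $\mathcal{G}(G,5)$ has diameter at most $6143\,n$, hence $O(n)$. -/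

import Mathlib

/-- `A` is a polygonal arc in the plane with ends `x` and `y`: the union of the segments of a broken
line `p 0 = x, p 1, …, p m = y` (with `m ≥ 1`) that does not cross or touch itself, i.e. consecutive
segments share only their common end and other pairs of segments are disjoint. -/
def IsPolygonalArc (A : Set (ℝ × ℝ)) (x y : ℝ × ℝ) : Prop :=
  ∃ (m : ℕ) (p : ℕ → ℝ × ℝ), 0 < m ∧ p 0 = x ∧ p m = y ∧
    (∀ i, i < m → p i ≠ p (i + 1)) ∧
    (∀ i, i + 1 < m →
      segment ℝ (p i) (p (i + 1)) ∩ segment ℝ (p (i + 1)) (p (i + 2)) = {p (i + 1)}) ∧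
    (∀ i j, i + 1 < j → j < m →
      Disjoint (segment ℝ (p i) (p (i + 1))) (segment ℝ (p j) (p (j + 1)))) ∧
    A = ⋃ i ∈ Finset.range m, segment ℝ (p i) (p (i + 1))

namespace SimpleGraph

/-- A drawing of the graph `G` in the plane without crossings: vertices are distinct points, every
edge is a polygonal arc joining its two ends, an edge passes through no vertex other than its ends,
and two different edges meet only in common ends. -/
structure PlaneDrawing {V : Type*} (G : SimpleGraph V) where
  /-- The point representing a vertex. -/
  pos : V → ℝ × ℝ
  /-- The arc representing an edge. -/
  arc : Sym2 V → Set (ℝ × ℝ)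
  pos_injective : Function.Injective pos
  isPolygonalArc : ∀ u v, G.Adj u v → IsPolygonalArc (arc s(u, v)) (pos u) (pos v)
  mem_of_pos_mem_arc : ∀ e ∈ G.edgeSet, ∀ w, pos w ∈ arc e → w ∈ e
  arc_inter_arc : ∀ e ∈ G.edgeSet, ∀ f ∈ G.edgeSet, e ≠ f →
    ∀ x ∈ arc e ∩ arc f, ∃ v, v ∈ e ∧ v ∈ f ∧ x = pos v

/-- A (finite) graph is planar if it can be drawn in the plane without crossings. -/
def IsPlanar {V : Type*} (G : SimpleGraph V) : Prop :=
  Nonempty G.PlaneDrawing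

/-- The `k`-recolouring graph of `G`: its vertices are the proper `k`-colourings of `G`, two being
adjacent if they differ on exactly one vertex of `G`. -/
def recolouringGraph {V : Type*} (G : SimpleGraph V) (k : ℕ) :
    SimpleGraph (G.Coloring (Fin k)) where
  Adj α β := ∃! v : V, α v ≠ β v
  symm := ⟨fun α β h => by simpa only [ne_comm] using h⟩
  loopless := ⟨fun α h => by
    obtain ⟨v, hv, -⟩ := h
    exact hv rfl⟩

/-- The number of steps of the recolouring sequence `w` that recolour the vertex `v`. -/
def recolourCount {V : Type*} {G : SimpleGraph V} {k : ℕ} {α β : G.Coloring (Fin k)}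
    (w : (G.recolouringGraph k).Walk α β) (v : V) : ℕ :=
  w.darts.countP (fun d => d.fst v ≠ d.snd v)

end SimpleGraph

/-! Recolouring sequences are extended one vertex at a time by looking ahead. Let `v` have `d`
neighbours in the part already recoloured, with `d + s < k`. Whenever `v` is in the way, it takes a
colour that avoids its present neighbours and the next `s` colours they will receive. So `v` moves
about once per `s` changes around it, plus one last move to its target (`Recolours.exists_insert`,
`RecolourableOn.insert_vertex`). With five colours, one present neighbour allows `s = 3` and two
allow `s = 2`.

Induction removes a set `S`: a root `x` with at most one neighbour outside `S`, and paths descending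
from `x` through vertices of degree 3 to vertices of degree at most 2. When `S` is put back from the
top, `x` moves about a third as often as the general bound, and every other vertex sees its
predecessor and at most one more vertex. The counts climb towards the bound along a path, but on at
most eleven vertices below the root they never pass 6143 (`RecolourableOn.of_sdiff`).

Such a set exists in every nonempty induced subgraph, by discharging. Otherwise each vertex has two
neighbours that are not lower neighbours. Face walks starting at vertices of degree 2 then climb
until they meet a vertex of degree at least 4, or for ten steps. With `N` the set of starting darts
of the latter kind, this gives `6F + |N| ≤ 2E` and `6V ≤ 4E + |N|`, against Euler's inequality `E +
1 ≤ V + F` (`exists_degree_le_lowerNeighbours`).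

Euler's inequality is derived from the drawing over `ZMod 2`. Counting crossings with a vertical ray
shows that every even edge set bounds a set of faces (`PlaneDrawing.exists_rotation`). The cycle
space has dimension at least `E - V`, and an even set together with the choice between a face set
and its complement is determined by a function on the faces; hence `E - V + 1 ≤ F`
(`IsPlanar.exists_face_permutation`). -/

namespace SimpleGraph

/-! ### Recolouring sequences and their extension to further vertices -/

/-- The function `f` is a proper colouring of the subgraph of `G` induced by `X`. -/
def ProperOn {V : Type*} {k : ℕ} (G : SimpleGraph V) (X : Finset V) (f : V → Fin k) : Prop :=
  ∀ u ∈ X, ∀ v ∈ X, G.Adj u v → f u ≠ f v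

/-- The list `L` of recolourings, performed one after the other, leads from `f` to `g` through
proper colourings of the subgraph induced by `X`. -/
inductive Recolours {V : Type*} [DecidableEq V] {k : ℕ} (G : SimpleGraph V) (X : Finset V) :
    (V → Fin k) → List (V × Fin k) → (V → Fin k) → Prop
  | nil (f : V → Fin k) (hf : G.ProperOn X f) : Recolours G X f [] f
  | cons (f : V → Fin k) (v : V) (c : Fin k) (L : List (V × Fin k)) (g : V → Fin k)
      (hf : G.ProperOn X f) (hv : v ∈ X) (h : Recolours G X (Function.update f v c) L g) :
      Recolours G X f ((v, c) :: L) g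

section Recolouring

variable {V : Type*} {k : ℕ} {G : SimpleGraph V} {X : Finset V}

theorem ProperOn.congr {f g : V → Fin k} (hf : G.ProperOn X f) (h : ∀ u ∈ X, g u = f u) :
    G.ProperOn X g := by
  intro u hu v hv huv
  rw [h u hu, h v hv]
  exact hf u hu v hv huv

theorem ProperOn.mono {Y : Finset V} {f : V → Fin k} (hf : G.ProperOn X f) (h : Y ⊆ X) :
    G.ProperOn Y f :=
  fun u hu v hv huv => hf u (h hu) v (h hv) huv

/-- A colour that avoids the colours in a short list and those on a small set of vertices. -/
theorem exists_colour (f : V → Fin k) (N : Finset V) (C : List (Fin k))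
    (h : N.card + C.length < k) : ∃ c : Fin k, c ∉ C ∧ ∀ u ∈ N, c ≠ f u := by
  have : ((N.image f) ∪ C.toFinset).card < Fintype.card (Fin k) := by
    rw [Fintype.card_fin]
    have h1 := Finset.card_union_le (N.image f) C.toFinset
    have h2 : (N.image f).card ≤ N.card := Finset.card_image_le
    have h3 := C.toFinset_card_le
    omega
  obtain ⟨c, hc⟩ := Finset.exists_mem_notMem_of_card_lt_card (s := (N.image f) ∪ C.toFinset)
    (t := Finset.univ) (by simpa using this)
  refine ⟨c, fun h => hc.2 (by simp [h]), fun u hu h => hc.2 ?_⟩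
  simp only [Finset.mem_union, Finset.mem_image]
  exact Or.inl ⟨u, hu, h.symm⟩

variable [DecidableEq V]

/-- The number of times that a list of recolourings recolours `u`. -/
def stepCount (u : V) (L : List (V × Fin k)) : ℕ := L.countP (fun p => p.1 = u)

theorem properOn_insert {v : V} {f : V → Fin k} (hf : G.ProperOn X f)
    (hv : ∀ u ∈ X, G.Adj v u → f v ≠ f u) : G.ProperOn (insert v X) f := by
  intro a ha b hb hab
  rcases Finset.mem_insert.1 ha with rfl | ha <;> rcases Finset.mem_insert.1 hb with rfl | hb
  · exact absurd hab (G.loopless.irrefl _)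
  · exact hv b hb hab
  · exact (hv a (by assumption) hab.symm).symm
  · exact hf a ha b hb hab

theorem Recolours.properOn_left {f g : V → Fin k} {L : List (V × Fin k)}
    (h : G.Recolours X f L g) : G.ProperOn X f := by
  cases h <;> assumption

theorem Recolours.properOn_right {f g : V → Fin k} {L : List (V × Fin k)}
    (h : G.Recolours X f L g) : G.ProperOn X g := by
  induction h <;> assumption

theorem Recolours.append {f g g' : V → Fin k} {L L' : List (V × Fin k)}
    (h : G.Recolours X f L g) (h' : G.Recolours X g L' g') : G.Recolours X f (L ++ L') g' := by
  induction h with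
  | nil => exact h'
  | cons f v c L g hf hv h ih => exact .cons f v c _ g' hf hv (ih h')

/-- The subgraph of `G` induced by `X` has a proper `k`-colouring, and any two of them are joined by
a recolouring sequence that recolours each vertex `u` at most `w u` times. -/
def RecolourableOn (G : SimpleGraph V) (k : ℕ) (X : Finset V) (w : V → ℕ) : Prop :=
  (∃ f : V → Fin k, G.ProperOn X f) ∧
  ∀ f g : V → Fin k, G.ProperOn X f → G.ProperOn X g → ∃ (L : List (V × Fin k)) (g' : V → Fin k),
    G.Recolours X f L g' ∧ (∀ u ∈ X, g' u = g u) ∧ ∀ u ∈ X, stepCount u L ≤ w u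

theorem RecolourableOn.mono {w w' : V → ℕ} (h : G.RecolourableOn k X w) (hw : ∀ u ∈ X, w u ≤ w' u) :
    G.RecolourableOn k X w' := by
  refine ⟨h.1, fun f g hf hg => ?_⟩
  obtain ⟨L, g', h1, h2, h3⟩ := h.2 f g hf hg
  exact ⟨L, g', h1, h2, fun u hu => (h3 u hu).trans (hw u hu)⟩

variable [DecidableRel G.Adj]

/-- The colours that the neighbours of `v` receive, in this order. -/
def neighbourColours (G : SimpleGraph V) [DecidableRel G.Adj] (v : V) (L : List (V × Fin k)) :
    List (Fin k) :=
  (L.filter (fun p => G.Adj v p.1)).map Prod.snd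

theorem length_neighbourColours {v : V} {f g : V → Fin k} {L : List (V × Fin k)}
    (h : G.Recolours X f L g) :
    (G.neighbourColours v L).length = ∑ u ∈ X.filter (G.Adj v), stepCount u L := by
  induction h with
  | nil => simp [neighbourColours, stepCount]
  | cons f w c L g hf hw h ih =>
    simp only [neighbourColours, stepCount, List.length_map] at ih ⊢
    simp only [List.countP_cons, List.filter_cons, Finset.sum_add_distrib, ← ih]
    by_cases hvw : G.Adj v w <;> simp [hvw, hw]

/-- A recolouring sequence on `X` can be accompanied by recolourings of one more vertex `v`, which
looks `s` changes of its neighbours ahead. -/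
theorem Recolours.exists_insert {v : V} (hv : v ∉ X) {s : ℕ} (hs : 0 < s)
    (hd : (X.filter (G.Adj v)).card + s < k) {f g : V → Fin k} {L : List (V × Fin k)}
    (h : G.Recolours X f L g) :
    ∀ (f' : V → Fin k) (j : ℕ), (∀ u ∈ X, f' u = f u) → G.ProperOn (insert v X) f' →
      (f' v ∉ (G.neighbourColours v L).take j) →
      ∃ (L' : List (V × Fin k)) (g' : V → Fin k), G.Recolours (insert v X) f' L' g' ∧
        (∀ u ∈ X, g' u = g u) ∧ (∀ u ∈ X, stepCount u L' = stepCount u L) ∧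
        stepCount v L' * s + 1 ≤ ((G.neighbourColours v L).length - j) + s := by
  induction h with
  | nil f hf =>
    intro f' j hag hp _
    exact ⟨[], f', .nil f' hp, hag, fun _ _ => rfl, by simp [stepCount]; omega⟩
  | cons f w c L g hf hw h ih =>
    -- one step of the sequence, when it does not conflict with the colour of `v`
    have key : ∀ (f' : V → Fin k) (j : ℕ), (∀ u ∈ X, f' u = f u) → G.ProperOn (insert v X) f' →
        (f' v ∉ (G.neighbourColours v L).take j) → (G.Adj v w → f' v ≠ c) →
        ∃ (L' : List (V × Fin k)) (g' : V → Fin k), G.Recolours (insert v X) f' L' g' ∧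
        (∀ u ∈ X, g' u = g u) ∧ (∀ u ∈ X, stepCount u L' = stepCount u ((w, c) :: L)) ∧
        stepCount v L' * s + 1 ≤ ((G.neighbourColours v L).length - j) + s := by
      intro f' j hag hp hj hc
      have hwv : v ≠ w := fun h => hv (h ▸ hw)
      have hag' : ∀ u ∈ X, Function.update f' w c u = Function.update f w c u := by
        intro u hu
        by_cases huw : u = w
        · subst huw; simp
        · simp [huw, hag u hu]
      have hp' : G.ProperOn (insert v X) (Function.update f' w c) := by
        refine properOn_insert (h.properOn_left.congr hag') fun u hu huv => ?_
        rw [Function.update_of_ne hwv]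
        by_cases huw : u = w
        · subst huw; simpa using hc huv
        · rw [Function.update_of_ne huw]
          exact hp v (Finset.mem_insert_self _ _) u (Finset.mem_insert_of_mem hu) huv
      obtain ⟨L', g', h1, h2, h3, h4⟩ := ih _ j hag' hp' (by rwa [Function.update_of_ne hwv])
      refine ⟨(w, c) :: L', g', .cons _ _ _ _ _ hp (Finset.mem_insert_of_mem hw) h1, h2, ?_, ?_⟩
      · intro u hu
        simp only [stepCount, List.countP_cons] at h3 ⊢
        rw [h3 u hu]
      · have : stepCount v ((w, c) :: L') = stepCount v L' := by
          simp [stepCount, hwv.symm]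
        rw [this]; exact h4
    intro f' j hag hp hj
    by_cases hadj : G.Adj v w
    · have hC : G.neighbourColours v ((w, c) :: L) = c :: G.neighbourColours v L := by
        simp [neighbourColours, hadj]
      rw [hC] at hj ⊢
      by_cases hc : f' v = c
      -- The next `j` neighbour changes are known to spare the colour of `v`, so a conflict now
      -- forces `j = 0`.
      · have hj0 : j = 0 := by
          rcases j with _ | j
          · rfl
          · simp [hc] at hj
        subst hj0
        -- The new colour avoids `c` and the `s - 1` neighbour changes after it, which becomes the
        -- new value of `j`.
        obtain ⟨a, ha1, ha2⟩ := exists_colour f' (X.filter (G.Adj v))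
          ((c :: G.neighbourColours v L).take s)
          (lt_of_le_of_lt (by gcongr; exact List.length_take_le _ _) hd)
        have hag' : ∀ u ∈ X, Function.update f' v a u = f u := by
          intro u hu
          rw [Function.update_of_ne (ne_of_mem_of_not_mem hu hv), hag u hu]
        have hp' : G.ProperOn (insert v X) (Function.update f' v a) := by
          refine properOn_insert (hf.congr hag') fun u hu huv => ?_
          rw [Function.update_self, Function.update_of_ne (ne_of_mem_of_not_mem hu hv)]
          exact ha2 u (by simp [hu, huv])
        obtain ⟨r, rfl⟩ : ∃ r, s = r + 1 := ⟨s - 1, by omega⟩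
        rw [List.take_succ_cons, List.mem_cons, not_or] at ha1
        obtain ⟨L', g', h1, h2, h3, h4⟩ := key (Function.update f' v a) r hag' hp'
          (by simpa using ha1.2) (fun _ => by simpa using ha1.1)
        refine ⟨(v, a) :: L', g', .cons _ _ _ _ _ hp (Finset.mem_insert_self _ _) h1, h2, ?_, ?_⟩
        · intro u hu
          have hvu : v ≠ u := (ne_of_mem_of_not_mem hu hv).symm
          rw [← h3 u hu]
          simp [stepCount, hvu]
        · have : stepCount v ((v, a) :: L') = stepCount v L' + 1 := by simp [stepCount]
          rw [this]
          simp only [List.length_cons, tsub_zero]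
          -- The subtraction is truncated: if fewer than `r` changes remain, the bound for the rest
          -- says that `v` never moves again.
          rcases le_or_gt r (G.neighbourColours v L).length with hle | hlt
          · rw [add_mul]; omega
          · have : stepCount v L' = 0 := by
              rw [Nat.sub_eq_zero_of_le hlt.le] at h4
              by_contra hne
              have := Nat.mul_le_mul_right (r + 1) (Nat.one_le_iff_ne_zero.2 hne)
              omega
            rw [this]; omega
      · obtain ⟨L', g', h1, h2, h3, h4⟩ := key f' (j - 1) hag hp
          (by
            rcases j with _ | j
            · simp
            · rw [List.take_succ_cons, List.mem_cons, not_or] at hj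
              exact hj.2) (fun _ => hc)
        refine ⟨L', g', h1, h2, h3, h4.trans ?_⟩
        simp only [List.length_cons]
        omega
    · have hC : G.neighbourColours v ((w, c) :: L) = G.neighbourColours v L := by
        simp [neighbourColours, hadj]
      rw [hC] at hj ⊢
      exact key f' j hag hp hj (fun h => absurd h hadj)

/-- Lookahead costs `v` at most the sum of its neighbours' counts divided by `s`, rounded up; one
more move brings it to its target colour. The condition `hw` is exactly room for both. -/
theorem RecolourableOn.insert_vertex {v : V} (hv : v ∉ X) {s : ℕ} (hs : 0 < s)
    (hd : (X.filter (G.Adj v)).card + s < k) {w : V → ℕ} (h : G.RecolourableOn k X w)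
    (hw : ∑ u ∈ X.filter (G.Adj v), w u + s ≤ w v * s) :
    G.RecolourableOn k (insert v X) w := by
  refine ⟨?_, fun f g hf hg => ?_⟩
  · obtain ⟨f, hf⟩ := h.1
    obtain ⟨c, -, hc⟩ := exists_colour f (X.filter (G.Adj v)) [] (by simp; omega)
    refine ⟨Function.update f v c, properOn_insert (hf.congr fun u hu => ?_) fun u hu huv => ?_⟩
    · rw [Function.update_of_ne (ne_of_mem_of_not_mem hu hv)]
    · rw [Function.update_self, Function.update_of_ne (ne_of_mem_of_not_mem hu hv)]
      exact hc u (by simp [hu, huv])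
  · obtain ⟨L, g', h1, h2, h3⟩ := h.2 f g (hf.mono (Finset.subset_insert _ _))
      (hg.mono (Finset.subset_insert _ _))
    obtain ⟨L', g'', h1', h2', h3', h4'⟩ := h1.exists_insert hv hs hd f 0 (fun _ _ => rfl) hf
      (by simp)
    have hag : ∀ u ∈ X, Function.update g'' v (g v) u = g u := by
      intro u hu
      rw [Function.update_of_ne (ne_of_mem_of_not_mem hu hv), h2' u hu, h2 u hu]
    have hag' : ∀ u ∈ insert v X, Function.update g'' v (g v) u = g u := by
      intro u hu
      rcases Finset.mem_insert.1 hu with rfl | hu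
      · simp
      · exact hag u hu
    refine ⟨L' ++ [(v, g v)], Function.update g'' v (g v), h1'.append
      (.cons _ _ _ _ _ h1'.properOn_right (Finset.mem_insert_self _ _)
        (.nil _ (hg.congr hag'))), hag', ?_⟩
    intro u hu
    rcases Finset.mem_insert.1 hu with rfl | hu
    · have hc : stepCount u (L' ++ [(u, g u)]) = stepCount u L' + 1 := by simp [stepCount]
      rw [hc]
      rw [length_neighbourColours h1] at h4'
      have hle : ∑ x ∈ X.filter (G.Adj u), stepCount x L ≤ ∑ x ∈ X.filter (G.Adj u), w x :=
        Finset.sum_le_sum fun x hx => h3 x (Finset.mem_filter.1 hx).1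
      by_contra! hlt
      have := Nat.mul_le_mul_right s (Nat.le_of_lt_succ hlt)
      omega
    · have hvu : v ≠ u := (ne_of_mem_of_not_mem hu hv).symm
      have hc : stepCount u (L' ++ [(v, g v)]) = stepCount u L' := by simp [stepCount, hvu]
      rw [hc, h3' u hu]
      exact h3 u hu

/-- A set `S` of vertices that can be put back one by one, starting from `x`. -/
theorem RecolourableOn.of_sdiff {S : Finset V} {x : V} {pos : V → ℕ} (hSX : S ⊆ X) (hxS : x ∈ S)
    (hx : ((X \ S).filter (G.Adj x)).card ≤ 1)
    (hpos : ∀ u ∈ S, u ≠ x → pos u ≤ 10)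
    (hparent : ∀ u ∈ S, u ≠ x → ∃ p ∈ S, G.Adj u p ∧ (p = x ∨ pos p = pos u + 1))
    (hdeg : ∀ u ∈ S, u ≠ x → (X.filter (G.Adj u)).card ≤ 2 ∨ (X.filter (G.Adj u)).card ≤ 3 ∧
      ∃ c ∈ S, c ≠ x ∧ G.Adj u c ∧ pos c < pos u)
    (h : G.RecolourableOn 5 (X \ S) fun _ => 6143) : G.RecolourableOn 5 X fun _ => 6143 := by
  -- The root needs `6143 + 3 ≤ 3 * 2049`. Below it, `2 * W u` must be at least `W p + 6143 + 2`, so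
  -- the deficit `6145 - W` may halve at each step down. It is `2 ^ 12` at the root and still `2` at
  -- position `0`, whence 6143.
  set W : V → ℕ := fun u => if u ∈ S then if u = x then 2049 else 6145 - 2 ^ (pos u + 1) else 6143
    with hW
  have hWle : ∀ u, W u ≤ 6143 := by
    intro u
    simp only [hW]
    split_ifs
    · norm_num
    · have : 2 ^ 1 ≤ 2 ^ (pos u + 1) := Nat.pow_le_pow_right (by norm_num) (by omega)
      omega
    · rfl
  have hbase : G.RecolourableOn 5 (insert x (X \ S)) W := by
    refine RecolourableOn.insert_vertex (s := 3) (by simp [hxS]) (by norm_num) (by omega)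
      (h.mono fun u hu => ?_) ?_
    · simp [hW, (Finset.mem_sdiff.1 hu).2]
    · have : ∑ u ∈ (X \ S).filter (G.Adj x), W u ≤ ((X \ S).filter (G.Adj x)).card • 6143 :=
        Finset.sum_le_card_nsmul _ _ _ fun u _ => hWle u
      have hWx : W x = 2049 := by simp [hW, hxS]
      rw [hWx]
      rw [smul_eq_mul] at this
      omega
  -- `Y` is closed upwards in `pos`. Removing its lowest vertex other than `x` preserves this, so
  -- vertices are put back from the highest down, each after its predecessor and before its lower
  -- neighbour `c`.
  suffices H : ∀ Y : Finset V, Y ⊆ X → X \ S ⊆ Y → x ∈ Y →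
      (∀ u ∈ Y, u ∈ S → u ≠ x → ∀ p ∈ S, pos u < pos p → p ∈ Y) → G.RecolourableOn 5 Y W by
    exact (H X subset_rfl Finset.sdiff_subset (hSX hxS) fun _ _ _ _ p hp _ => hSX hp).mono
      fun u _ => hWle u
  intro Y
  induction Y using Finset.strongInduction with
  | H Y ih =>
    intro hYX hXY hxY hup
    by_cases hne : ((Y ∩ S).erase x).Nonempty
    · obtain ⟨u, hu, hmin⟩ := Finset.exists_min_image _ pos hne
      simp only [Finset.mem_erase, Finset.mem_inter] at hu hmin
      obtain ⟨hux, huY, huS⟩ := hu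
      have hY : Y = insert u (Y.erase u) := (Finset.insert_erase huY).symm
      obtain ⟨p, hpS, hup', hp⟩ := hparent u huS hux
      have hpY : p ∈ Y := by
        rcases hp with rfl | hp
        · exact hxY
        · exact hup u huY huS hux p hpS (by omega)
      have hrec : G.RecolourableOn 5 (Y.erase u) W := by
        refine ih _ (Finset.erase_ssubset huY) ((Finset.erase_subset _ _).trans hYX) ?_
          (Finset.mem_erase.2 ⟨hux.symm, hxY⟩) ?_
        · intro a ha
          exact Finset.mem_erase.2 ⟨fun h => (Finset.mem_sdiff.1 ha).2 (h ▸ huS), hXY ha⟩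
        · intro a ha haS hax q hq hlt
          have haY := Finset.mem_of_mem_erase ha
          refine Finset.mem_erase.2 ⟨?_, hup a haY haS hax q hq hlt⟩
          rintro rfl
          have := hmin a ⟨hax, haY, haS⟩
          omega
      have hN : ((Y.erase u).filter (G.Adj u)).card ≤ 2 := by
        rcases hdeg u huS hux with h2 | ⟨h3, c, hcS, hcx, huc, hcu⟩
        · refine (Finset.card_le_card ?_).trans h2
          exact Finset.filter_subset_filter _ ((Finset.erase_subset _ _).trans hYX)
        · have hcY : c ∉ Y := by
            intro hcY
            have := hmin c ⟨hcx, hcY, hcS⟩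
            omega
          have : ((Y.erase u).filter (G.Adj u)).card < (X.filter (G.Adj u)).card := by
            apply Finset.card_lt_card
            refine ⟨Finset.filter_subset_filter _ ((Finset.erase_subset _ _).trans hYX), ?_⟩
            intro hsub
            have := hsub (Finset.mem_filter.2 ⟨hSX hcS, huc⟩)
            exact hcY (Finset.mem_of_mem_erase (Finset.mem_filter.1 this).1)
          omega
      rw [hY]
      refine hrec.insert_vertex (s := 2) (by simp) (by norm_num) (by omega) ?_
      have hpN : p ∈ (Y.erase u).filter (G.Adj u) := by
        simp [hpY, hup', hup'.ne']
      rw [← Finset.add_sum_erase _ _ hpN]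
      have h1 : ∑ q ∈ ((Y.erase u).filter (G.Adj u)).erase p, W q ≤ 1 * 6143 := by
        refine (Finset.sum_le_card_nsmul _ _ 6143 fun q _ => hWle q).trans ?_
        rw [smul_eq_mul]
        refine Nat.mul_le_mul_right _ ?_
        rw [Finset.card_erase_of_mem hpN]
        omega
      have hpu := hpos u huS hux
      -- If `p` is the root this is `2049 + 2 ^ 12 = 6145` in the worst case `pos u = 10`; otherwise
      -- it is the definition of `W p`.
      have h2 : W p + 2 ^ (pos u + 2) ≤ 6145 := by
        have h12 : 2 ^ (pos u + 2) ≤ 2 ^ 12 := Nat.pow_le_pow_right (by norm_num) (by omega)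
        simp only [hW, if_pos hpS]
        split_ifs with hpx
        · norm_num at h12 ⊢; omega
        · rcases hp with hp | hp
          · exact absurd hp hpx
          · rw [hp, show pos u + 1 + 1 = pos u + 2 by ring]
            omega
      have h3 : W u = 6145 - 2 ^ (pos u + 1) := by simp [hW, huS, hux]
      have h4 : 2 ^ (pos u + 2) = 2 * 2 ^ (pos u + 1) := by ring
      omega
    · have : Y = insert x (X \ S) := by
        rw [Finset.not_nonempty_iff_eq_empty] at hne
        ext a
        constructor
        · intro ha
          by_cases hax : a = x
          · simp [hax]
          · have : a ∉ S := by
              intro haS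
              have : a ∈ (Y ∩ S).erase x := by simp [hax, ha, haS]
              simp [hne] at this
            simp [hYX ha, this]
        · intro ha
          rcases Finset.mem_insert.1 ha with rfl | ha
          · exact hxY
          · exact hXY ha
      rw [this]
      exact hbase

end Recolouring

end SimpleGraph

/-! ### Reducible sets and heights above the vertices of degree at most 2 -/

namespace SimpleGraph

section Reducible

/-- A set `S` of vertices of the subgraph of `G` induced by `X`, with a root `x` and heights `pos`,
such that recolourings of the rest extend to `S`. -/
def Reducible {V : Type*} (G : SimpleGraph V) (X : Finset V) : Prop :=
  open Classical in
  ∃ S ⊆ X, ∃ x ∈ S, ∃ pos : V → ℕ, ((X \ S).filter (G.Adj x)).card ≤ 1 ∧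
    ∀ u ∈ S, u ≠ x → pos u ≤ 10 ∧ (∃ p ∈ S, G.Adj u p ∧ (p = x ∨ pos p = pos u + 1)) ∧
      ((X.filter (G.Adj u)).card ≤ 2 ∨ (X.filter (G.Adj u)).card ≤ 3 ∧
        ∃ c ∈ S, c ≠ x ∧ G.Adj u c ∧ pos c < pos u)

theorem recolourableOn_of_reducible {V : Type*} {G : SimpleGraph V} [DecidableEq V]
    (h : ∀ X : Finset V, X.Nonempty → G.Reducible X) (X : Finset V) :
    G.RecolourableOn 5 X fun _ => 6143 := by
  classical
  induction X using Finset.strongInduction with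
  | H X ih =>
    rcases X.eq_empty_or_nonempty with rfl | hX
    · have hp : ∀ f : V → Fin 5, G.ProperOn ∅ f := fun f u hu => absurd hu (Finset.notMem_empty _)
      exact ⟨⟨fun _ => 0, hp _⟩, fun f g hf _ => ⟨[], f, .nil f hf, by simp, by simp⟩⟩
    · obtain ⟨S, hSX, x, hxS, pos, hx, hS⟩ := h X hX
      refine RecolourableOn.of_sdiff hSX hxS (by convert hx) (fun u hu hux => (hS u hu hux).1)
        (fun u hu hux => (hS u hu hux).2.1) (fun u hu hux => ?_)
        (ih _ (Finset.sdiff_ssubset hSX ⟨x, hxS⟩))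
      convert (hS u hu hux).2.2

theorem Reducible.of_induce {V : Type*} {G : SimpleGraph V} {X : Finset V}
    (h : (G.induce (X : Set V)).Reducible Finset.univ) : G.Reducible X := by
  classical
  obtain ⟨S, -, x, hxS, pos, hx, hS⟩ := h
  let ι : (X : Set V) ↪ V := Function.Embedding.subtype _
  have hmem : ∀ u ∈ X, ∀ hu : u ∈ (X : Set V), u ∈ S.map ι ↔ (⟨u, hu⟩ : (X : Set V)) ∈ S := by
    intro u hu hu'
    simp only [Finset.mem_map]
    constructor
    · rintro ⟨a, ha, rfl⟩; exact ha
    · intro ha; exact ⟨_, ha, rfl⟩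
  have hfil : ∀ u : (X : Set V), X.filter (G.Adj u) =
      (Finset.univ.filter ((G.induce (X : Set V)).Adj u)).map ι := by
    intro u
    ext v
    simp only [Finset.mem_filter, Finset.mem_map, Finset.mem_univ, true_and]
    constructor
    · rintro ⟨hv, huv⟩; exact ⟨⟨v, hv⟩, huv, rfl⟩
    · rintro ⟨a, ha, rfl⟩; exact ⟨a.2, ha⟩
  have hpos : ∀ u : (X : Set V), (fun v => if hv : v ∈ (X : Set V) then pos ⟨v, hv⟩ else 0) u =
      pos u := fun u => by simp
  refine ⟨S.map ι, ?_, x, Finset.mem_map_of_mem ι hxS,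
    fun v => if hv : v ∈ (X : Set V) then pos ⟨v, hv⟩ else 0, ?_, ?_⟩
  · intro v hv
    obtain ⟨a, -, rfl⟩ := Finset.mem_map.1 hv
    exact a.2
  · have : (X \ S.map ι).filter (G.Adj x) =
        ((Finset.univ \ S).filter ((G.induce (X : Set V)).Adj x)).map ι := by
      ext v
      simp only [Finset.mem_filter, Finset.mem_map, Finset.mem_sdiff, Finset.mem_univ, true_and]
      constructor
      · rintro ⟨⟨hv, hvS⟩, hxv⟩
        exact ⟨⟨v, hv⟩, ⟨fun h => hvS ⟨_, h, rfl⟩, hxv⟩, rfl⟩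
      · rintro ⟨a, ⟨haS, hxa⟩, rfl⟩
        refine ⟨⟨a.2, ?_⟩, hxa⟩
        rintro ⟨b, hb, hba⟩
        exact haS (ι.injective hba ▸ hb)
    rw [this, Finset.card_map]
    convert hx
  · intro u hu hux
    obtain ⟨u, huS, rfl⟩ := Finset.mem_map.1 hu
    have hux' : u ≠ x := fun h => hux (h ▸ rfl)
    obtain ⟨h1, ⟨p, hpS, hup, hp⟩, h3⟩ := hS u huS hux'
    refine ⟨?_, ⟨p, Finset.mem_map_of_mem ι hpS, hup, ?_⟩, ?_⟩
    · rw [show ι u = (u : V) from rfl, hpos]; exact h1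
    · rw [show ι u = (u : V) from rfl, hpos, hpos]
      exact hp.imp (fun h => by rw [h]) id
    · rw [show ι u = (u : V) from rfl, hfil, Finset.card_map]
      refine h3.imp id fun h => ⟨h.1, ?_⟩
      obtain ⟨c, hcS, hcx, huc, hcu⟩ := h.2
      exact ⟨c, Finset.mem_map_of_mem ι hcS, fun h => hcx (Subtype.ext h), huc,
        by rw [hpos, hpos]; exact hcu⟩

end Reducible

section Levels

variable {W : Type*} [Fintype W] [DecidableEq W] (H : SimpleGraph W) [DecidableRel H.Adj]

/-- The vertices of degree at most `2`, and the vertices of degree `3` that are joined to one of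
them by a path of at most `k` edges in which all other vertices have degree `3`. -/
def lowLevel : ℕ → Finset W
  | 0 => Finset.univ.filter fun v => H.degree v ≤ 2
  | k + 1 => lowLevel k ∪ Finset.univ.filter fun v => H.degree v = 3 ∧ ∃ u ∈ lowLevel k, H.Adj v u

/-- The least level that contains `v`. -/
noncomputable def height (v : W) : ℕ := sInf {k | v ∈ H.lowLevel k}

/-- The neighbours of `x` in the levels up to `10` that do not lie higher than `x`. -/
noncomputable def lowerNeighbours (x : W) : Finset W :=
  (H.neighborFinset x).filter fun u =>
    u ∈ H.lowLevel 10 ∧ (x ∈ H.lowLevel 10 → H.height u ≤ H.height x)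

variable {H}

theorem mem_lowerNeighbours {x u : W} : u ∈ H.lowerNeighbours x ↔
    H.Adj x u ∧ u ∈ H.lowLevel 10 ∧ (x ∈ H.lowLevel 10 → H.height u ≤ H.height x) := by
  simp [lowerNeighbours]

theorem lowLevel_mono : Monotone H.lowLevel :=
  monotone_nat_of_le_succ fun _ => Finset.subset_union_left

theorem height_le {k : ℕ} {v : W} (h : v ∈ H.lowLevel k) : H.height v ≤ k := Nat.sInf_le h

theorem mem_lowLevel_height {k : ℕ} {v : W} (h : v ∈ H.lowLevel k) :
    v ∈ H.lowLevel (H.height v) := Nat.sInf_mem (s := {k | v ∈ H.lowLevel k}) ⟨k, h⟩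

/-- Membership in some level is essential: a vertex in no level also has height `0`, the infimum of
the empty set. -/
theorem degree_le_two_of_height {k : ℕ} {v : W} (h : v ∈ H.lowLevel k) (h0 : H.height v = 0) :
    H.degree v ≤ 2 := by
  have := mem_lowLevel_height h
  rw [h0] at this
  simpa [lowLevel] using this

theorem mem_lowLevel_zero {v : W} (h : H.degree v ≤ 2) : v ∈ H.lowLevel 0 := by
  simpa [lowLevel] using h

theorem height_eq_zero {v : W} (h : H.degree v ≤ 2) : H.height v = 0 :=
  Nat.le_zero.1 (height_le (mem_lowLevel_zero h))

theorem mem_lowLevel_succ {k : ℕ} {u v : W} (h : u ∈ H.lowLevel k) (hv : H.degree v = 3)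
    (huv : H.Adj v u) : v ∈ H.lowLevel (k + 1) := by
  simp only [lowLevel, Finset.mem_union, Finset.mem_filter, Finset.mem_univ, true_and]
  exact Or.inr ⟨hv, u, h, huv⟩

theorem exists_height_add_one {k : ℕ} {v : W} (h : v ∈ H.lowLevel k) (h0 : H.height v ≠ 0) :
    H.degree v = 3 ∧ ∃ u ∈ H.lowLevel k, H.Adj v u ∧ H.height u + 1 = H.height v := by
  obtain ⟨m, hm⟩ := Nat.exists_eq_succ_of_ne_zero h0
  have hv := mem_lowLevel_height h
  rw [hm] at hv
  simp only [lowLevel, Finset.mem_union, Finset.mem_filter, Finset.mem_univ, true_and] at hv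
  rcases hv with hv | ⟨hd, u, hu, huv⟩
  · have := height_le hv
    omega
  · have hmk : m ≤ k := by have := height_le h; omega
    refine ⟨hd, u, lowLevel_mono hmk hu, huv, ?_⟩
    have h1 := height_le hu
    have h2 := height_le (mem_lowLevel_succ (mem_lowLevel_height hu) hd huv)
    omega

theorem degree_le_three {k : ℕ} {v : W} (h : v ∈ H.lowLevel k) : H.degree v ≤ 3 := by
  by_cases h0 : H.height v = 0
  · exact (degree_le_two_of_height h h0).trans (by norm_num)
  · exact (exists_height_add_one h h0).1.le

/-- The vertices on the descending paths from a set of vertices. -/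
inductive Descends (ch : W → W) (ht : W → ℕ) (A : Finset W) : W → Prop
  | base (u : W) (hu : u ∈ A) : Descends ch ht A u
  | step (u : W) (hu : Descends ch ht A u) (h0 : ht u ≠ 0) : Descends ch ht A (ch u)

/-- `S` consists of `x` and one strictly descending path from each lower neighbour. All neighbours
of `x` but at most one are then in `S`, and each vertex of degree 3 on a path has its successor
below it. -/
theorem reducible_of_degree_le {x : W} (hx : H.degree x ≤ (H.lowerNeighbours x).card + 1) :
    H.Reducible Finset.univ := by
  classical
  have hex : ∀ v : W, ∃ u : W, v ∈ H.lowLevel 10 → H.height v ≠ 0 →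
      u ∈ H.lowLevel 10 ∧ H.Adj v u ∧ H.height u + 1 = H.height v := by
    intro v
    by_cases h : v ∈ H.lowLevel 10 ∧ H.height v ≠ 0
    · obtain ⟨u, hu⟩ := (exists_height_add_one h.1 h.2).2
      exact ⟨u, fun _ _ => hu⟩
    · exact ⟨v, fun h1 h2 => absurd ⟨h1, h2⟩ h⟩
  choose ch hch using hex
  -- The paths never run into `x`: if `x` is low, they start no higher than `x` and then drop
  -- strictly.
  have hD : ∀ u, Descends ch H.height (H.lowerNeighbours x) u →
      u ∈ H.lowLevel 10 ∧ u ≠ x ∧ (x ∈ H.lowLevel 10 → H.height u ≤ H.height x) := by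
    intro u hu
    induction hu with
    | base u hu =>
      rw [mem_lowerNeighbours] at hu
      exact ⟨hu.2.1, hu.1.ne', hu.2.2⟩
    | step u hu h0 ih =>
      obtain ⟨h1, h2, h3⟩ := hch u ih.1 h0
      refine ⟨h1, ?_, fun hx => ?_⟩
      · intro h
        rw [h] at h1 h3
        have := ih.2.2 h1
        omega
      · have := ih.2.2 hx
        omega
  refine ⟨insert x (Finset.univ.filter (Descends ch H.height (H.lowerNeighbours x))),
    Finset.subset_univ _, x, Finset.mem_insert_self _ _, H.height, ?_, ?_⟩
  · have hsub : ((Finset.univ \ insert x (Finset.univ.filter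
        (Descends ch H.height (H.lowerNeighbours x)))).filter (H.Adj x)) ⊆
        H.neighborFinset x \ H.lowerNeighbours x := by
      intro v hv
      simp only [Finset.mem_filter, Finset.mem_sdiff, Finset.mem_univ, true_and, Finset.mem_insert,
        not_or] at hv
      simp only [Finset.mem_sdiff, mem_neighborFinset]
      exact ⟨hv.2, fun h => hv.1.2 (.base v h)⟩
    suffices h : (H.neighborFinset x \ H.lowerNeighbours x).card ≤ 1 by
      convert Nat.le_trans (Finset.card_le_card hsub) h
    have hsub' : H.lowerNeighbours x ⊆ H.neighborFinset x := Finset.filter_subset _ _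
    rw [Finset.card_sdiff_of_subset hsub', card_neighborFinset_eq_degree]
    omega
  · intro u hu hux
    replace hu : Descends ch H.height (H.lowerNeighbours x) u := by simpa [hux] using hu
    have hdeg : (Finset.univ.filter (H.Adj u)).card = H.degree u := by
      rw [← card_neighborFinset_eq_degree]
      congr 1
      ext; simp
    refine ⟨height_le (hD u hu).1, ?_, ?_⟩
    · rcases hu with ⟨u, hu⟩ | ⟨u, hu, h0⟩
      · exact ⟨x, Finset.mem_insert_self _ _, (mem_lowerNeighbours.1 hu).1.symm, Or.inl rfl⟩
      · obtain ⟨h1, h2, h3⟩ := hch u (hD u hu).1 h0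
        exact ⟨u, by simp [hu], h2.symm, Or.inr h3.symm⟩
    · by_cases h0 : H.height u = 0
      · left
        have := Nat.le_trans hdeg.le (degree_le_two_of_height (hD u hu).1 h0)
        convert this
      · right
        obtain ⟨h1, h2, h3⟩ := hch u (hD u hu).1 h0
        have hc := Descends.step u hu h0
        have h4 := Nat.le_trans hdeg.le (exists_height_add_one (hD u hu).1 h0).1.le
        exact ⟨by convert h4, ch u, by simp [hc],
          (hD _ hc).2.1, h2, by omega⟩

end Levels

end SimpleGraph

/-! ### Short closed walks and the discharging argument -/

namespace SimpleGraph

section Girth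

variable {W : Type*} {H : SimpleGraph W}

theorem not_cycle_three (hg : 6 ≤ H.egirth) {a b c : W} (hab : H.Adj a b) (hbc : H.Adj b c)
    (hca : H.Adj c a) : False := by
  have hw : (Walk.cons hab (.cons hbc (.cons hca .nil))).IsCycle := by
    simp [Walk.isCycle_def, Walk.isTrail_def, hab.ne, hbc.ne, hca.ne, hab.ne', hca.ne']
  have := hg.trans (egirth_le_length hw)
  norm_num [Walk.length_cons] at this

theorem not_cycle_four (hg : 6 ≤ H.egirth) {a b c d : W} (hab : H.Adj a b) (hbc : H.Adj b c)
    (hcd : H.Adj c d) (hda : H.Adj d a) (hac : a ≠ c) (hbd : b ≠ d) : False := by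
  have hw : (Walk.cons hab (.cons hbc (.cons hcd (.cons hda .nil)))).IsCycle := by
    simp [Walk.isCycle_def, Walk.isTrail_def, hab.ne, hbc.ne, hcd.ne, hda.ne, hab.ne', hda.ne', hac,
      hbd, hac.symm]
  have := hg.trans (egirth_le_length hw)
  norm_num [Walk.length_cons] at this

theorem not_cycle_five (hg : 6 ≤ H.egirth) {a b c d e : W} (hab : H.Adj a b) (hbc : H.Adj b c)
    (hcd : H.Adj c d) (hde : H.Adj d e) (hea : H.Adj e a) (hac : a ≠ c) (hbd : b ≠ d) (hce : c ≠ e)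
    (hda : d ≠ a) (heb : e ≠ b) : False := by
  have hw : (Walk.cons hab (.cons hbc (.cons hcd (.cons hde (.cons hea .nil))))).IsCycle := by
    simp [Walk.isCycle_def, Walk.isTrail_def, hab.ne, hbc.ne, hcd.ne, hde.ne, hea.ne, hab.ne',
      hea.ne', hac, hbd, hce, hda, hac.symm, hda.symm, heb.symm]
  have := hg.trans (egirth_le_length hw)
  norm_num [Walk.length_cons] at this

/-- The walks along a permutation of the darts that never turns back are not closed after fewer
than six steps. -/
theorem iterate_ne_of_egirth (hg : 6 ≤ H.egirth) (φ : H.Dart → H.Dart)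
    (hφ : ∀ d, (φ d).fst = d.snd) (hback : ∀ d, φ d ≠ d.symm) (d : H.Dart) {m : ℕ} (h0 : 0 < m)
    (hm : m < 6) : φ^[m] d ≠ d := by
  intro h
  set a : ℕ → W := fun i => (φ^[i] d).fst with ha
  have hsnd : ∀ i, (φ^[i] d).snd = a (i + 1) := by
    intro i
    simp only [ha, Function.iterate_succ_apply', hφ]
  have hadj : ∀ i, H.Adj (a i) (a (i + 1)) := by
    intro i
    rw [← hsnd]
    exact (φ^[i] d).adj
  have hne : ∀ i, a i ≠ a (i + 2) := by
    intro i hi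
    apply hback (φ^[i] d)
    apply Dart.ext
    apply Prod.ext
    · rw [hφ]; rfl
    · change (φ (φ^[i] d)).snd = (φ^[i] d).fst
      have h1 := hsnd (i + 1)
      rw [Function.iterate_succ_apply'] at h1
      rw [h1]
      exact hi.symm
  have hper : ∀ i, a (i + m) = a i := by
    intro i
    simp only [ha, Function.iterate_add_apply, h]
  have h0' := hper 0
  have h1' := hper 1
  have a0 := hadj 0
  have a1 := hadj 1
  have a2 := hadj 2
  have a3 := hadj 3
  have a4 := hadj 4
  have n0 := hne 0
  have n1 := hne 1
  have n2 := hne 2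
  have n3 := hne 3
  have n4 := hne 4
  interval_cases m <;> norm_num at h0' h1' a0 a1 a2 a3 a4 n0 n1 n2 n3 n4
  · exact a0.ne h0'.symm
  · exact n0 h0'.symm
  · rw [h0'] at a2
    exact not_cycle_three hg a0 a1 a2
  · rw [h0'] at a3
    exact not_cycle_four hg a0 a1 a2 a3 n0 n1
  · rw [h0'] at a4 n3
    rw [h1'] at n4
    exact not_cycle_five hg a0 a1 a2 a3 a4 n0 n1 n2 n3 n4

end Girth

section Discharging

variable {W : Type*} [Fintype W] [DecidableEq W] (H : SimpleGraph W) [DecidableRel H.Adj]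

/-- The dart `d` leaves a vertex of height `i` upwards. -/
def Ascends (i : ℕ) (d : H.Dart) : Prop :=
  d.fst ∈ H.lowLevel 10 ∧ H.height d.fst = i ∧ d.snd ∉ H.lowerNeighbours d.fst

variable {H}

theorem ascends_zero (hlow : ∀ x, (H.lowerNeighbours x).card + 2 ≤ H.degree x) {d : H.Dart}
    (hd : H.degree d.fst = 2) : H.Ascends 0 d := by
  refine ⟨lowLevel_mono (Nat.zero_le _) (mem_lowLevel_zero hd.le), height_eq_zero hd.le, ?_⟩
  have := hlow d.fst
  have : H.lowerNeighbours d.fst = ∅ := Finset.card_eq_zero.1 (by omega)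
  simp [this]

/-- The head of `d` is not of degree 2, since it would then be a lower neighbour of the tail. So it
has degree 3 and height `i + 1`. The tail is one of its lower neighbours, and by `hlow` the only
one, so any continuation except turning back ascends again. -/
theorem Ascends.succ (hlow : ∀ x, (H.lowerNeighbours x).card + 2 ≤ H.degree x) {i : ℕ}
    (hi : i < 10) {d e : H.Dart} (hd : H.Ascends i d) (hde : e.fst = d.snd) (hback : e ≠ d.symm)
    (hdeg : H.degree d.snd < 4) : H.Ascends (i + 1) e := by
  obtain ⟨h1, h2, h3⟩ := hd
  rw [mem_lowerNeighbours] at h3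
  have hge : 2 ≤ H.degree d.snd := le_trans (by omega) (hlow d.snd)
  have h3' : d.snd ∈ H.lowLevel 10 → i < H.height d.snd := by
    intro hm
    by_contra! hle
    exact h3 ⟨d.adj, hm, fun _ => by omega⟩
  have hd3 : H.degree d.snd = 3 := by
    by_contra hne
    have h2' : H.degree d.snd ≤ 2 := by omega
    have := h3' (lowLevel_mono (Nat.zero_le _) (mem_lowLevel_zero h2'))
    rw [height_eq_zero h2'] at this
    omega
  have hmem := mem_lowLevel_succ (mem_lowLevel_height h1) hd3 d.adj.symm
  rw [h2] at hmem
  have hmem10 := lowLevel_mono (show i + 1 ≤ 10 by omega) hmem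
  have hh := height_le hmem
  have hh' := h3' hmem10
  refine ⟨hde ▸ hmem10, by rw [hde]; omega, ?_⟩
  rw [hde]
  intro he
  have hdl : d.fst ∈ H.lowerNeighbours d.snd :=
    mem_lowerNeighbours.2 ⟨d.adj.symm, h1, fun _ => by omega⟩
  have hne : e.snd ≠ d.fst := by
    intro h
    exact hback (Dart.ext _ _ (Prod.ext hde h))
  have := Finset.one_lt_card.2 ⟨_, he, _, hdl, hne⟩
  have := hlow d.snd
  omega

/-- Either a face walk from a vertex of degree `2` ascends for ten steps or it reaches a vertex of
degree at least `4` before. -/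
theorem ascends_or_exists_exit (hlow : ∀ x, (H.lowerNeighbours x).card + 2 ≤ H.degree x)
    (φ : H.Dart → H.Dart) (hφ : ∀ d, (φ d).fst = d.snd) (hback : ∀ d, φ d ≠ d.symm) {d : H.Dart}
    (hd : H.degree d.fst = 2) : (∀ i ≤ 10, H.Ascends i (φ^[i] d)) ∨
      ∃ i, H.Ascends i (φ^[i] d) ∧ 4 ≤ H.degree (φ^[i] d).snd := by
  by_cases h : ∃ i, H.Ascends i (φ^[i] d) ∧ 4 ≤ H.degree (φ^[i] d).snd
  · exact Or.inr h
  · left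
    push Not at h
    intro i
    induction i with
    | zero => exact fun _ => ascends_zero hlow hd
    | succ i ih =>
      intro hi
      have hi' := ih (by omega)
      rw [Function.iterate_succ_apply']
      exact hi'.succ hlow (by omega) (hφ _) (hback _) (h i hi')

/-- If no such `x` exists, every degree is at least 2. Adding the face count `hface` and the vertex
count `hvert` cancels `N` and leaves `6V + 6F ≤ 6E`, which contradicts `hcount`. -/
theorem exists_degree_le_lowerNeighbours [Nonempty W] (hg : 6 ≤ H.egirth)
    (φ : Equiv.Perm H.Dart) (hφ : ∀ d, (φ d).fst = d.snd)
    (hback : ∀ d, φ d = d.symm → H.degree d.snd ≤ 1)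
    (hcount : H.edgeFinset.card + 1 ≤
      Fintype.card W + Nat.card (Quotient (Equiv.Perm.SameCycle.setoid φ))) :
    ∃ x, H.degree x ≤ (H.lowerNeighbours x).card + 1 := by
  classical
  by_contra! hlow
  replace hlow : ∀ x, (H.lowerNeighbours x).card + 2 ≤ H.degree x := fun x => hlow x
  replace hback : ∀ d, φ d ≠ d.symm := fun d h => by
    have := hback d h
    have := hlow d.snd
    omega
  set N : Finset H.Dart := Finset.univ.filter fun d =>
    H.degree d.fst = 2 ∧ ∀ i ≤ 10, H.Ascends i (φ^[i] d) with hN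
  have hE : Fintype.card H.Dart = 2 * H.edgeFinset.card := H.dart_card_eq_twice_card_edges
  -- faces
  have hface : 6 * Nat.card (Quotient (Equiv.Perm.SameCycle.setoid φ)) + N.card ≤
      Fintype.card H.Dart := by
    let q : H.Dart → Quotient (Equiv.Perm.SameCycle.setoid φ) := Quotient.mk _
    have hq : ∀ (d : H.Dart) (i : ℕ), q (φ^[i] d) = q d := by
      intro d i
      refine Quotient.sound ?_
      change φ.SameCycle _ _
      rw [← Equiv.Perm.coe_pow, Equiv.Perm.sameCycle_pow_left]
    have h1 : Fintype.card H.Dart = ∑ c, (Finset.univ.filter fun d => q d = c).card := by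
      rw [← Finset.card_univ]
      exact Finset.card_eq_sum_card_fiberwise (fun _ _ => Finset.mem_coe.2 (Finset.mem_univ _))
    have h2 : N.card = ∑ c, (N.filter fun d => q d = c).card :=
      Finset.card_eq_sum_card_fiberwise (fun _ _ => Finset.mem_coe.2 (Finset.mem_univ _))
    rw [h1, h2, Nat.card_eq_fintype_card, ← Finset.card_univ, mul_comm, ← smul_eq_mul,
      ← Finset.sum_const, ← Finset.sum_add_distrib]
    refine Finset.sum_le_sum fun c _ => ?_
    by_cases h0 : (N.filter fun d => q d = c).card = 0
    · rw [h0, add_zero]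
      induction c using Quotient.inductionOn with
      | h d =>
        rw [← Finset.card_range 6]
        refine Finset.card_le_card_of_injOn (fun i => φ^[i] d) ?_ ?_
        · intro i _
          simpa using hq d i
        · have key : ∀ i j : ℕ, i < j → j < 6 → φ^[i] d ≠ φ^[j] d := by
            intro i j hij hj h
            obtain ⟨r, rfl⟩ := Nat.exists_eq_add_of_lt hij
            rw [add_assoc, Function.iterate_add_apply] at h
            exact iterate_ne_of_egirth hg φ hφ hback d (m := r + 1) (by omega) (by omega)
              ((φ.injective.iterate i) h).symm
          intro i hi j hj hij
          simp only [Finset.coe_range, Set.mem_Iio] at hi hj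
          rcases lt_trichotomy i j with h | h | h
          · exact absurd hij (key i j h hj)
          · exact h
          · exact absurd hij.symm (key j i h hi)
    -- Each dart of `N` claims eleven darts of its face. They are disjoint for different starts,
    -- because the height of the tail reveals the number of steps. A face with `n ≥ 1` such darts
    -- thus has at least `11n ≥ 6 + n` darts.
    · have : ((N.filter fun d => q d = c) ×ˢ Finset.range 11).card ≤
          (Finset.univ.filter fun d => q d = c).card := by
        refine Finset.card_le_card_of_injOn (fun p => φ^[p.2] p.1) ?_ ?_
        · rintro ⟨d, i⟩ hd
          simp only [Finset.coe_product, Set.mem_prod, Finset.mem_coe, Finset.mem_filter] at hd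
          simp [hq, hd.1.2]
        · rintro ⟨d, i⟩ hd ⟨e, j⟩ he hde
          simp only [hN, Finset.coe_product, Set.mem_prod, Finset.mem_coe, Finset.mem_filter,
            Finset.mem_range] at hd he
          have hi := (hd.1.1.2.2 i (by omega)).2.1
          have hj := (he.1.1.2.2 j (by omega)).2.1
          simp only at hde
          rw [hde, hj] at hi
          subst hi
          rw [(φ.injective.iterate j) hde]
      rw [Finset.card_product, Finset.card_range] at this
      omega
  -- vertices
  have hvert : 6 * Fintype.card W ≤ 2 * Fintype.card H.Dart + N.card := by
    set M : Finset H.Dart := Finset.univ.filter fun e =>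
      4 ≤ H.degree e.snd ∧ e.fst ∈ H.lowerNeighbours e.snd with hM
    -- A walk that does not climb ten steps exits into a vertex of degree at least 4. The exit dart
    -- determines the start: walk back as many steps as the height of its tail.
    have hB : (Finset.univ.filter fun d : H.Dart => H.degree d.fst = 2).card ≤
        N.card + M.card := by
      refine (Finset.card_le_card (t := N ∪ M.image fun e => φ.symm^[H.height e.fst] e) ?_).trans
        ((Finset.card_union_le _ _).trans (Nat.add_le_add_left Finset.card_image_le _))
      intro d hd
      simp only [Finset.mem_filter, Finset.mem_univ, true_and] at hd
      rcases ascends_or_exists_exit hlow φ hφ hback hd with h | ⟨i, hi, hdeg⟩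
      · exact Finset.mem_union_left _ (by simpa [hN, hd] using h)
      · refine Finset.mem_union_right _ (Finset.mem_image.2 ⟨φ^[i] d, ?_, ?_⟩)
        · simp only [hM, Finset.mem_filter, Finset.mem_univ, true_and]
          refine ⟨hdeg, mem_lowerNeighbours.2 ⟨(φ^[i] d).adj.symm, hi.1, fun h => ?_⟩⟩
          have := degree_le_three h
          omega
        · rw [hi.2.1]
          exact Function.LeftInverse.iterate φ.symm_apply_apply i d
    have hB' : (Finset.univ.filter fun d : H.Dart => H.degree d.fst = 2).card =
        ∑ x, if H.degree x = 2 then 2 else 0 := by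
      rw [Finset.card_eq_sum_card_fiberwise (f := fun d : H.Dart => d.fst) (t := Finset.univ)
        (fun _ _ => Finset.mem_coe.2 (Finset.mem_univ _))]
      refine Finset.sum_congr rfl fun x _ => ?_
      rw [Finset.filter_filter]
      split_ifs with hx
      · refine Eq.trans ?_ ((H.dart_fst_fiber_card_eq_degree x).trans hx)
        congr 1
        ext d
        simp only [Finset.mem_filter, Finset.mem_univ, true_and]
        exact ⟨fun h => h.2, fun h => ⟨by rw [h, hx], h⟩⟩
      · rw [Finset.card_eq_zero, Finset.filter_eq_empty_iff]
        rintro d - ⟨h1, rfl⟩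
        exact hx h1
    have hM' : M.card ≤ ∑ x, if 4 ≤ H.degree x then (H.lowerNeighbours x).card else 0 := by
      rw [Finset.card_eq_sum_card_fiberwise (f := fun d : H.Dart => d.snd) (t := Finset.univ)
        (fun _ _ => Finset.mem_coe.2 (Finset.mem_univ _))]
      refine Finset.sum_le_sum fun x _ => ?_
      split_ifs with hx
      · refine Finset.card_le_card_of_injOn (fun d => d.fst) ?_ ?_
        · intro d hd
          simp only [hM, Finset.mem_coe, Finset.mem_filter, Finset.mem_univ, true_and] at hd
          rw [← hd.2]
          exact hd.1.2
        · intro d hd e he hde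
          simp only [Finset.mem_coe, Finset.mem_filter] at hd he
          exact Dart.ext _ _ (Prod.ext hde (hd.2.trans he.2.symm))
      · rw [Nat.le_zero, Finset.card_eq_zero, Finset.filter_eq_empty_iff]
        rintro d hd rfl
        exact hx (Finset.mem_filter.1 hd).2.1
    -- Per vertex: degree 2 gives `6 ≤ 4 + 2`, degree 3 gives `6 ≤ 6`, and degree `d ≥ 4` gives `6 +
    -- (d - 2) ≤ 2d`.
    have hsum : ∑ _x : W, 6 + ∑ x, (if 4 ≤ H.degree x then (H.lowerNeighbours x).card else 0) ≤
        2 * ∑ x, H.degree x + ∑ x, if H.degree x = 2 then 2 else 0 := by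
      rw [Finset.mul_sum, ← Finset.sum_add_distrib, ← Finset.sum_add_distrib]
      refine Finset.sum_le_sum fun x _ => ?_
      have := hlow x
      split_ifs <;> omega
    rw [← H.dart_card_eq_sum_degrees, Finset.sum_const, Finset.card_univ, smul_eq_mul] at hsum
    omega
  omega

end Discharging

end SimpleGraph

/-! ### Cyclic order of darts around a point -/

section CyclicOrder

/-- `σ` moves to the next larger key at the same point and from the largest back to the smallest.
Partial sums of `z` grow by `z (σ d)` even at the wrap, because the full sum at a point is zero. -/
theorem exists_cyclic_successor {D P K : Type*} [Fintype D] [DecidableEq P] [LinearOrder K]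
    (src : D → P) (key : D → K) (hkey : ∀ d e, src d = src e → key d = key e → d = e) :
    ∃ σ : Equiv.Perm D, (∀ d, src (σ d) = src d) ∧ (∀ d, σ d = d → ∀ e, src e = src d → e = d) ∧
      ∀ z : D → ZMod 2, (∀ d, ∑ e, (if src e = src d then z e else 0) = 0) → ∀ d,
        ∑ e, (if src e = src d ∧ key e ≤ key (σ d) then z e else 0) =
          ∑ e, (if src e = src d ∧ key e ≤ key d then z e else 0) + z (σ d) := by
  classical
  have hex : ∀ d, ∃ e, src e = src d ∧
      ((key d < key e ∧ ∀ e', src e' = src d → key d < key e' → key e ≤ key e') ∨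
        ((∀ e', src e' = src d → key e' ≤ key d) ∧ ∀ e', src e' = src d → key e ≤ key e')) := by
    intro d
    by_cases h : (Finset.univ.filter fun e => src e = src d ∧ key d < key e).Nonempty
    · obtain ⟨e, he, hmin⟩ := Finset.exists_min_image _ key h
      simp only [Finset.mem_filter, Finset.mem_univ, true_and] at he hmin
      exact ⟨e, he.1, Or.inl ⟨he.2, fun e' h1 h2 => hmin e' ⟨h1, h2⟩⟩⟩
    · have h' : (Finset.univ.filter fun e => src e = src d).Nonempty := ⟨d, by simp⟩
      obtain ⟨e, he, hmin⟩ := Finset.exists_min_image _ key h'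
      simp only [Finset.mem_filter, Finset.mem_univ, true_and] at he hmin
      refine ⟨e, he, Or.inr ⟨fun e' h1 => ?_, hmin⟩⟩
      by_contra! hlt
      exact h ⟨e', by simp [h1, hlt]⟩
  choose s hs1 hs2 using hex
  have hinj : Function.Injective s := by
    intro d e hde
    have hsrc : src d = src e := by rw [← hs1 d, hde, hs1 e]
    have h1 := hs2 d
    have h2 := hs2 e
    rw [← hde] at h2
    rcases h1 with ⟨h1, h1'⟩ | ⟨h1, h1'⟩ <;> rcases h2 with ⟨h2, h2'⟩ | ⟨h2, h2'⟩
    · refine hkey _ _ hsrc (le_antisymm ?_ ?_)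
      · by_contra! hlt
        exact absurd (h2' d hsrc hlt) (not_le.2 h1)
      · by_contra! hlt
        exact absurd (h1' e hsrc.symm hlt) (not_le.2 h2)
    · exact absurd (h2' d hsrc) (not_le.2 h1)
    · exact absurd (h1' e hsrc.symm) (not_le.2 h2)
    · exact hkey _ _ hsrc (le_antisymm (h2 d hsrc) (h1 e hsrc.symm))
  refine ⟨Equiv.ofBijective s hinj.bijective_of_finite, hs1, ?_, ?_⟩
  · intro d hd e he
    change s d = d at hd
    have h := hs2 d
    rw [hd] at h
    rcases h with ⟨h, -⟩ | ⟨h1, h2⟩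
    · exact absurd h (lt_irrefl _)
    · exact hkey _ _ he (le_antisymm (h1 e he) (h2 e he))
  · intro z hz d
    change ∑ e, (if src e = src d ∧ key e ≤ key (s d) then z e else 0) = _ + z (s d)
    rcases hs2 d with ⟨h1, h2⟩ | ⟨h1, h2⟩
    · have : z (s d) = ∑ e, if e = s d then z e else 0 := by simp
      rw [this, ← Finset.sum_add_distrib]
      refine Finset.sum_congr rfl fun e _ => ?_
      by_cases he : e = s d
      · subst he
        simp [hs1, h1]
      · have : (src e = src d ∧ key e ≤ key (s d)) ↔ (src e = src d ∧ key e ≤ key d) := by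
          refine and_congr_right fun hsrc => ⟨fun h => ?_, fun h => h.trans h1.le⟩
          by_contra! hlt
          exact he (hkey _ _ (hsrc.trans (hs1 d).symm) (le_antisymm h (h2 e hsrc hlt)))
        simp [this, he]
    · have e1 : ∑ e, (if src e = src d ∧ key e ≤ key d then z e else 0) = 0 := by
        refine (Finset.sum_congr rfl fun e _ => ?_).trans (hz d)
        have : (src e = src d ∧ key e ≤ key d) ↔ src e = src d :=
          ⟨fun h => h.1, fun h => ⟨h, h1 e h⟩⟩
        simp [this]
      have e2 : z (s d) = ∑ e, if e = s d then z e else 0 := by simp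
      rw [e1, zero_add, e2]
      refine Finset.sum_congr rfl fun e _ => ?_
      have : (src e = src d ∧ key e ≤ key (s d)) ↔ e = s d := by
        constructor
        · rintro ⟨h, h'⟩
          exact hkey _ _ (h.trans (hs1 d).symm) (le_antisymm h' (h2 e h))
        · rintro rfl
          exact ⟨hs1 d, le_rfl⟩
      simp [this]

end CyclicOrder

/-! ### Straight-line drawings: parity of crossings with a vertical ray -/

section StraightLine

/-- The darts of a straight-line drawing, given by their starting points `p` and the reversal `rev`:
different segments meet only in common ends. -/
structure IsStraightDrawing {D : Type*} (rev : D → D) (p : D → ℝ × ℝ) : Prop where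
  rev_rev : ∀ d, rev (rev d) = d
  ne_rev : ∀ d, p d ≠ p (rev d)
  meet : ∀ d e, e ≠ d → e ≠ rev d → ∀ x ∈ segment ℝ (p d) (p (rev d)),
    x ∈ segment ℝ (p e) (p (rev e)) → (x = p d ∨ x = p (rev d)) ∧ (x = p e ∨ x = p (rev e))

variable {D : Type*} (rev : D → D) (p : D → ℝ × ℝ)

/-- The slope of a dart. -/
noncomputable def dartSlope (d : D) : ℝ :=
  ((p (rev d)).2 - (p d).2) / ((p (rev d)).1 - (p d).1)

/-- The ordinate of the line through a dart over the abscissa `t`. -/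
noncomputable def dartHeight (d : D) (t : ℝ) : ℝ := (p d).2 + dartSlope rev p d * (t - (p d).1)

/-- The dart goes from left to right. -/
def IsRight (d : D) : Prop := (p d).1 < (p (rev d)).1

variable {rev p}

theorem dartHeight_left (d : D) : dartHeight rev p d (p d).1 = (p d).2 := by simp [dartHeight]

section

variable (hD : IsStraightDrawing rev p) (hx : ∀ d e, (p d).1 = (p e).1 → p d = p e)

include hD

theorem dartSlope_rev (d : D) : dartSlope rev p (rev d) = dartSlope rev p d := by
  rw [dartSlope, dartSlope, hD.rev_rev, ← neg_sub, ← neg_sub (p (rev d)).1, neg_div_neg_eq]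

include hx

theorem abscissa_ne (d : D) : (p d).1 ≠ (p (rev d)).1 := fun h => hD.ne_rev d (hx _ _ h)

theorem isRight_rev (d : D) : IsRight rev p (rev d) ↔ ¬ IsRight rev p d := by
  have := abscissa_ne hD hx d
  rw [IsRight, IsRight, hD.rev_rev, not_lt]
  exact ⟨le_of_lt, fun h => lt_of_le_of_ne h this.symm⟩

theorem dartHeight_right (d : D) : dartHeight rev p d (p (rev d)).1 = (p (rev d)).2 := by
  have : (p (rev d)).1 - (p d).1 ≠ 0 := sub_ne_zero.2 (abscissa_ne hD hx d).symm
  rw [dartHeight, dartSlope]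
  field_simp
  ring

theorem dartHeight_rev (d : D) (t : ℝ) : dartHeight rev p (rev d) t = dartHeight rev p d t := by
  have h := dartHeight_right hD hx d
  rw [dartHeight] at h
  rw [dartHeight, dartHeight, dartSlope_rev hD, ← h]
  ring

theorem mem_segment_of_dartHeight (d : D) {t : ℝ} (ht : t ∈ Set.uIcc (p d).1 (p (rev d)).1) :
    (t, dartHeight rev p d t) ∈ segment ℝ (p d) (p (rev d)) := by
  rw [← segment_eq_uIcc, segment_eq_image_lineMap] at ht
  obtain ⟨θ, hθ, rfl⟩ := ht
  rw [segment_eq_image_lineMap]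
  refine ⟨θ, hθ, ?_⟩
  have : (p (rev d)).1 - (p d).1 ≠ 0 := sub_ne_zero.2 (abscissa_ne hD hx d).symm
  ext
  · simp [AffineMap.lineMap_apply]
  · simp only [AffineMap.lineMap_apply, dartHeight, dartSlope, vsub_eq_sub, smul_eq_mul,
      vadd_eq_add, Prod.snd_add, Prod.smul_snd, Prod.snd_sub]
    field_simp
    ring

theorem dartHeight_meet {d e : D} (h1 : e ≠ d) (h2 : e ≠ rev d) {t : ℝ}
    (hd : t ∈ Set.uIcc (p d).1 (p (rev d)).1) (he : t ∈ Set.uIcc (p e).1 (p (rev e)).1)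
    (h : dartHeight rev p d t = dartHeight rev p e t) :
    (t = (p d).1 ∨ t = (p (rev d)).1) ∧ (t = (p e).1 ∨ t = (p (rev e)).1) := by
  have hd' := mem_segment_of_dartHeight hD hx d hd
  have he' := mem_segment_of_dartHeight hD hx e he
  rw [← h] at he'
  obtain ⟨a, b⟩ := hD.meet d e h1 h2 _ hd' he'
  exact ⟨a.imp (congrArg Prod.fst) (congrArg Prod.fst),
    b.imp (congrArg Prod.fst) (congrArg Prod.fst)⟩

theorem ne_rev_of_isRight {d e : D} (hd : IsRight rev p d) (he : IsRight rev p e) : e ≠ rev d := by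
  rintro rfl
  exact (isRight_rev hD hx d).1 he hd

theorem eq_of_dartHeight_eq {d e : D} (hd : IsRight rev p d) (he : IsRight rev p e) {t : ℝ}
    (hd1 : (p d).1 ≤ t) (hd2 : t ≤ (p (rev d)).1) (he1 : (p e).1 < t) (he2 : t < (p (rev e)).1)
    (h : dartHeight rev p d t = dartHeight rev p e t) : d = e := by
  by_contra hne
  obtain ⟨-, h' | h'⟩ := dartHeight_meet hD hx (Ne.symm hne) (ne_rev_of_isRight hD hx hd he)
    (Set.mem_uIcc.2 (Or.inl ⟨hd1, hd2⟩)) (Set.mem_uIcc.2 (Or.inl ⟨he1.le, he2.le⟩)) h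
  · exact he1.ne' h'
  · exact he2.ne h'

theorem dartHeight_ne {c e : D} (he : IsRight rev p e) (h1 : (p e).1 < (p c).1)
    (h2 : (p c).1 < (p (rev e)).1) : (p c).2 ≠ dartHeight rev p e (p c).1 := by
  intro h
  rw [← dartHeight_left (rev := rev) c] at h
  by_cases hc : IsRight rev p c
  · rw [eq_of_dartHeight_eq hD hx hc he le_rfl hc.le h1 h2 h] at h1
    exact lt_irrefl _ h1
  · have hc' := (isRight_rev hD hx c).2 hc
    have hlt := hc'
    rw [IsRight, hD.rev_rev] at hlt
    rw [← dartHeight_rev hD hx] at h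
    have := eq_of_dartHeight_eq hD hx hc' he hlt.le (by rw [hD.rev_rev]) h1 h2 h
    rw [← this, hD.rev_rev] at h2
    exact lt_irrefl _ h2

end

end StraightLine

section StraightLine

variable {D : Type*} {rev : D → D} {p : D → ℝ × ℝ}

/-- Right-going darts before left-going ones, each of these by slope: the counterclockwise order. -/
noncomputable def dartKey (rev : D → D) (p : D → ℝ × ℝ) (d : D) : ℕ ×ₗ ℝ :=
  open Classical in toLex (if IsRight rev p d then 0 else 1, dartSlope rev p d)

theorem dartKey_le_of_isRight {d e : D} (he : IsRight rev p e) :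
    dartKey rev p d ≤ dartKey rev p e ↔
      IsRight rev p d ∧ dartSlope rev p d ≤ dartSlope rev p e := by
  by_cases hd : IsRight rev p d <;> simp [dartKey, Prod.Lex.toLex_le_toLex, hd, he]

theorem dartKey_le_of_not_isRight {d e : D} (he : ¬ IsRight rev p e) :
    dartKey rev p d ≤ dartKey rev p e ↔
      (IsRight rev p d ∨ dartSlope rev p d ≤ dartSlope rev p e) := by
  by_cases hd : IsRight rev p d <;> simp [dartKey, Prod.Lex.toLex_le_toLex, hd, he]

/-- `a + k * s` is the vertical difference of two segments that do not meet strictly between two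
abscissas. Each side of the equivalence expresses that it is negative in between, read off at one
end with the slope deciding ties. -/
theorem affine_sign_iff {a b k l : ℝ} (hl : 0 < l) (hb : b = a + k * l)
    (h : ∀ s, 0 < s → s < l → a + k * s ≠ 0) :
    (a < 0 ∨ a = 0 ∧ k ≤ 0) ↔ (b < 0 ∨ b = 0 ∧ 0 ≤ k) := by
  have root : ∀ (_ : 0 < -a / k) (_ : -a / k < l) (_ : k ≠ 0), False := fun h1 h2 h3 =>
    h _ h1 h2 (by field_simp; ring)
  have hmid := h (l / 2) (by linarith) (by linarith)
  constructor
  · rintro (ha | ⟨ha, hk⟩)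
    · by_contra! hcon
      obtain ⟨h1, h2⟩ := hcon
      rcases h1.lt_or_eq with h1 | h1
      · have hk : 0 < k := by
          by_contra! hk
          nlinarith
        exact root (div_pos (by linarith) hk) (by rw [div_lt_iff₀ hk]; linarith) hk.ne'
      · have := h2 h1.symm
        nlinarith
    · subst ha
      rcases hk.lt_or_eq with hk | hk
      · left; rw [hb]; nlinarith
      · subst hk; simp at hmid
  · rintro (hb' | ⟨hb', hk⟩)
    · by_contra! hcon
      obtain ⟨h1, h2⟩ := hcon
      rcases h1.lt_or_eq with h1 | h1
      · have hk : k < 0 := by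
          by_contra! hk
          nlinarith
        exact root (div_pos_of_neg_of_neg (by linarith) hk)
          (by rw [div_lt_iff_of_neg hk]; linarith) hk.ne
      · have := h2 h1.symm
        nlinarith
    · rcases hk.lt_or_eq with hk | hk
      · left; nlinarith
      · subst hk
        exfalso
        apply hmid
        linarith

section

variable (hD : IsStraightDrawing rev p) (hx : ∀ d e, (p d).1 = (p e).1 → p d = p e)

include hD hx

theorem dartKey_injective {d e : D} (hp : p d = p e) (h : dartKey rev p d = dartKey rev p e) :
    d = e := by
  by_contra hne
  have hrev : e ≠ rev d := by
    rintro rfl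
    exact hD.ne_rev d hp
  have hs : dartSlope rev p d = dartSlope rev p e := congrArg (fun k => (ofLex k).2) h
  have hh : ∀ t, dartHeight rev p d t = dartHeight rev p e t := by
    intro t
    rw [dartHeight, dartHeight, hp, hs]
  have hr : IsRight rev p d ↔ IsRight rev p e := by
    have h1 := (congrArg (fun k => (ofLex k).1) h)
    by_cases hd : IsRight rev p d <;> by_cases he : IsRight rev p e <;>
      simp [dartKey, hd, he] at h1 ⊢
  have key := fun t hd he => (dartHeight_meet hD hx (Ne.symm hne) hrev (t := t) hd he (hh t))
  by_cases hd : IsRight rev p d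
  · have he := hr.1 hd
    rw [IsRight] at hd he
    rw [← hp] at he
    -- Midway between the common start and the nearer far end, both segments would share a point
    -- that is no end of `d`.
    set r := min (p (rev d)).1 (p (rev e)).1 with hr'
    have h1 : (p d).1 < r := lt_min hd he
    have h2 : r ≤ (p (rev d)).1 := min_le_left _ _
    have h3 : r ≤ (p (rev e)).1 := min_le_right _ _
    obtain ⟨h4 | h4, -⟩ := key (((p d).1 + r) / 2)
      (Set.mem_uIcc.2 (Or.inl ⟨by linarith, by linarith⟩))
      (Set.mem_uIcc.2 (Or.inl ⟨by rw [← hp]; linarith, by linarith⟩)) <;> linarith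
  · have he := mt hr.2 hd
    have hd' := lt_of_le_of_ne (not_lt.1 hd) (abscissa_ne hD hx d).symm
    have he' := lt_of_le_of_ne (not_lt.1 he) (abscissa_ne hD hx e).symm
    rw [← hp] at he'
    set r := max (p (rev d)).1 (p (rev e)).1 with hr'
    have h1 : r < (p d).1 := max_lt hd' he'
    have h2 : (p (rev d)).1 ≤ r := le_max_left _ _
    have h3 : (p (rev e)).1 ≤ r := le_max_right _ _
    obtain ⟨h4 | h4, -⟩ := key (((p d).1 + r) / 2)
      (Set.mem_uIcc.2 (Or.inr ⟨by linarith, by linarith⟩))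
      (Set.mem_uIcc.2 (Or.inr ⟨by linarith, by rw [← hp]; linarith⟩)) <;> linarith

end

section Sums

variable [Fintype D] (rev p) (z : D → ZMod 2)

open Classical in
/-- The sum of `z` over the segments that pass below the starting point of `c`. -/
noncomputable def sumBelow (c : D) : ZMod 2 :=
  ∑ d, if IsRight rev p d ∧ (p d).1 < (p c).1 ∧ (p c).1 < (p (rev d)).1 ∧
    dartHeight rev p d (p c).1 < (p c).2 then z d else 0

open Classical in
/-- The sum of `z` over the segments that do not lie above `e` just to the right of the abscissa
`t`. -/
noncomputable def sumRightOf (e : D) (t : ℝ) : ZMod 2 :=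
  ∑ d, if IsRight rev p d ∧ (p d).1 ≤ t ∧ t < (p (rev d)).1 ∧
    (dartHeight rev p d t < dartHeight rev p e t ∨ dartHeight rev p d t = dartHeight rev p e t ∧
      dartSlope rev p d ≤ dartSlope rev p e) then z d else 0

open Classical in
/-- The sum of `z` over the segments that do not lie above `e` just to the left of the abscissa
`t`. -/
noncomputable def sumLeftOf (e : D) (t : ℝ) : ZMod 2 :=
  ∑ d, if IsRight rev p d ∧ (p d).1 < t ∧ t ≤ (p (rev d)).1 ∧
    (dartHeight rev p d t < dartHeight rev p e t ∨ dartHeight rev p d t = dartHeight rev p e t ∧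
      dartSlope rev p e ≤ dartSlope rev p d) then z d else 0

variable {rev p z} (hD : IsStraightDrawing rev p) (hx : ∀ d e, (p d).1 = (p e).1 → p d = p e)

include hD hx

theorem sumRightOf_eq_sumLeftOf {e : D} (he : IsRight rev p e) {t t' : ℝ} (htt' : t < t')
    (h1 : (p e).1 ≤ t) (h2 : t' ≤ (p (rev e)).1) (hno : ∀ c, ¬ (t < (p c).1 ∧ (p c).1 < t')) :
    sumRightOf rev p z e t = sumLeftOf rev p z e t' := by
  classical
  refine Finset.sum_congr rfl fun d _ => if_congr (and_congr_right fun hd => ?_) rfl rfl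
  have hl : (p d).1 ≤ t ↔ (p d).1 < t' :=
    ⟨fun h => h.trans_lt htt', fun h => not_lt.1 fun h' => hno d ⟨h', h⟩⟩
  have hr : t < (p (rev d)).1 ↔ t' ≤ (p (rev d)).1 :=
    ⟨fun h => not_lt.1 fun h' => hno _ ⟨h, h'⟩, fun h => htt'.trans_le h⟩
  rw [← and_assoc, ← and_assoc, hl, hr]
  refine and_congr_left' Iff.rfl |>.trans (and_congr_right fun hsp => ?_)
  rw [← hl, ← hr] at hsp
  by_cases hde : d = e
  · subst hde
    simp
  have hsp' := hr.1 hsp.2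
  have hb : dartHeight rev p d t' - dartHeight rev p e t' =
      (dartHeight rev p d t - dartHeight rev p e t) +
        (dartSlope rev p d - dartSlope rev p e) * (t' - t) := by
    simp only [dartHeight]; ring
  have := affine_sign_iff (sub_pos.2 htt') hb (by
    intro s hs hs' h0
    have hh : dartHeight rev p d (t + s) = dartHeight rev p e (t + s) := by
      simp only [dartHeight] at h0 ⊢
      linarith
    exact hde (eq_of_dartHeight_eq hD hx hd he (by linarith) (by linarith) (by linarith)
      (by linarith) hh))
  simpa only [sub_neg, sub_eq_zero, sub_nonpos, sub_nonneg] using this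

/-- At every point the sum over the segments that end there from the left equals the sum over those
that start there to the right. -/
theorem sum_ending_eq_sum_starting (hz : ∀ d, z (rev d) = z d) (c : D) [DecidableEq (ℝ × ℝ)]
    [DecidablePred (IsRight rev p)]
    (hc : ∑ e, (if p e = p c then z e else 0) = 0) :
    ∑ d, (if IsRight rev p d ∧ p (rev d) = p c then z d else 0) =
      ∑ d, if IsRight rev p d ∧ p d = p c then z d else 0 := by
  have h1 : ∑ d, (if IsRight rev p d ∧ p (rev d) = p c then z d else 0) =
      ∑ d, if ¬ IsRight rev p d ∧ p d = p c then z d else 0 := by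
    refine Fintype.sum_equiv (Function.Involutive.toPerm rev hD.rev_rev) _ _ fun d => ?_
    have := isRight_rev hD hx d
    change _ = if ¬ IsRight rev p (rev d) ∧ p (rev d) = p c then z (rev d) else 0
    simp only [this, not_not, hz]
  rw [h1, ← sub_eq_zero, CharTwo.sub_eq_add, ← Finset.sum_add_distrib]
  refine (Finset.sum_congr rfl fun d _ => ?_).trans hc
  by_cases h : IsRight rev p d <;> by_cases h' : p d = p c <;> simp [h, h']

/-- Passing the abscissa of a point inside the span of `e` only replaces the segments ending at that
point by those starting there. If the point is below `e`, their sums agree by evenness; if above,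
neither is counted. -/
theorem sumLeftOf_eq_sumRightOf (hz : ∀ d, z (rev d) = z d) [DecidableEq (ℝ × ℝ)]
    {c e : D} (hc : ∑ e, (if p e = p c then z e else 0) = 0) (he : IsRight rev p e)
    (h1 : (p e).1 < (p c).1) (h2 : (p c).1 < (p (rev e)).1) :
    sumLeftOf rev p z e (p c).1 = sumRightOf rev p z e (p c).1 := by
  classical
  have hmid : ∀ d, IsRight rev p d → (p d).1 < (p c).1 → (p c).1 < (p (rev d)).1 →
      dartHeight rev p d (p c).1 = dartHeight rev p e (p c).1 → d = e :=
    fun d hd hd1 hd2 h => eq_of_dartHeight_eq hD hx hd he hd1.le hd2.le h1 h2 h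
  have hne := dartHeight_ne hD hx he h1 h2
  set M : ZMod 2 := ∑ d, if IsRight rev p d ∧ (p d).1 < (p c).1 ∧ (p c).1 < (p (rev d)).1 ∧
    dartHeight rev p d (p c).1 ≤ dartHeight rev p e (p c).1 then z d else 0 with hM
  have hL : sumLeftOf rev p z e (p c).1 = M + ∑ d, if (IsRight rev p d ∧ p (rev d) = p c) ∧
      (p c).2 < dartHeight rev p e (p c).1 then z d else 0 := by
    rw [hM, sumLeftOf, ← Finset.sum_add_distrib]
    refine Finset.sum_congr rfl fun d _ => ?_
    by_cases hd : IsRight rev p d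
    swap
    · simp [hd]
    rcases lt_trichotomy (p c).1 (p (rev d)).1 with h | h | h
    · have hpc : p (rev d) ≠ p c := fun h' => h.ne' (congrArg Prod.fst h')
      simp only [hd, h.le, h, hpc, true_and, and_false, false_and, if_false, add_zero]
      refine if_congr (and_congr_right fun hl => ?_) rfl rfl
      refine Iff.trans ?_ le_iff_lt_or_eq.symm
      refine or_congr Iff.rfl ⟨fun h => h.1, fun h' => ⟨h', ?_⟩⟩
      rw [hmid d hd hl h h']
    · have hpc : p (rev d) = p c := hx _ _ h.symm
      have hd' := hd
      rw [IsRight, ← h] at hd'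
      have hh := dartHeight_right hD hx d
      rw [hpc] at hh
      simp [hd, hpc, hh, hne, hd']
    · have hpc : p (rev d) ≠ p c := fun h' => h.ne (congrArg Prod.fst h')
      simp [hpc, not_le.2 h, not_lt.2 h.le]
  have hR : sumRightOf rev p z e (p c).1 = M + ∑ d, if (IsRight rev p d ∧ p d = p c) ∧
      (p c).2 < dartHeight rev p e (p c).1 then z d else 0 := by
    rw [hM, sumRightOf, ← Finset.sum_add_distrib]
    refine Finset.sum_congr rfl fun d _ => ?_
    by_cases hd : IsRight rev p d
    swap
    · simp [hd]
    rcases lt_trichotomy (p d).1 (p c).1 with h | h | h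
    · have hpc : p d ≠ p c := fun h' => h.ne (congrArg Prod.fst h')
      simp only [hd, h.le, h, hpc, true_and, and_false, false_and, if_false, add_zero]
      refine if_congr (and_congr_right fun hl => ?_) rfl rfl
      refine Iff.trans ?_ le_iff_lt_or_eq.symm
      refine or_congr Iff.rfl ⟨fun h => h.1, fun h' => ⟨h', ?_⟩⟩
      rw [hmid d hd h hl h']
    · have hpc : p d = p c := hx _ _ h
      have hd' := hd
      rw [IsRight, h] at hd'
      have hh := dartHeight_left (rev := rev) (p := p) d
      rw [hpc] at hh
      simp [hd, hpc, hh, hne, hd']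
    · have hpc : p d ≠ p c := fun h' => h.ne' (congrArg Prod.fst h')
      simp [hpc, not_le.2 h, not_lt.2 h.le]
  rw [hL, hR]
  congr 1
  by_cases hB : (p c).2 < dartHeight rev p e (p c).1
  · simp only [hB, and_true]
    exact sum_ending_eq_sum_starting hD hx hz c hc
  · simp [hB]

/-- The sum over the segments that do not lie above `e` is the same at both ends of `e`. -/
theorem sumRightOf_eq_sumLeftOf_ends (hz : ∀ d, z (rev d) = z d) [DecidableEq (ℝ × ℝ)]
    (hev : ∀ c, ∑ e, (if p e = p c then z e else 0) = 0) {e : D} (he : IsRight rev p e) :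
    sumRightOf rev p z e (p e).1 = sumLeftOf rev p z e (p (rev e)).1 := by
  classical
  -- Sweep along `e`, with induction on the number of abscissas strictly between its start and `c`.
  suffices H : ∀ (n : ℕ) (c : D), (p e).1 < (p c).1 → (p c).1 ≤ (p (rev e)).1 →
      ((Finset.univ.image fun d => (p d).1).filter fun t => (p e).1 < t ∧ t < (p c).1).card = n →
      sumRightOf rev p z e (p e).1 = sumLeftOf rev p z e (p c).1 from
    H _ (rev e) he le_rfl rfl
  intro n
  induction n using Nat.strong_induction_on with
  | _ n ih =>
    intro c h1 h2 hn
    by_cases hne : ((Finset.univ.image fun d => (p d).1).filter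
        fun t => (p e).1 < t ∧ t < (p c).1).Nonempty
    · obtain ⟨t, ht, hmax⟩ := Finset.exists_max_image _ id hne
      simp only [Finset.mem_filter, Finset.mem_image, Finset.mem_univ, true_and, id] at ht hmax
      obtain ⟨⟨d, rfl⟩, h3, h4⟩ := ht
      have hlt : ((Finset.univ.image fun d => (p d).1).filter
          fun t => (p e).1 < t ∧ t < (p d).1).card < n := by
        rw [← hn]
        refine Finset.card_lt_card ⟨fun t ht => ?_, fun hsub => ?_⟩
        · simp only [Finset.mem_filter] at ht ⊢
          exact ⟨ht.1, ht.2.1, ht.2.2.trans h4⟩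
        · have := hsub (Finset.mem_filter.2 ⟨Finset.mem_image_of_mem _ (Finset.mem_univ d), h3, h4⟩)
          exact lt_irrefl _ (Finset.mem_filter.1 this).2.2
      rw [ih _ hlt d h3 (h4.le.trans h2) rfl,
        sumLeftOf_eq_sumRightOf hD hx hz (hev d) he h3 (h4.trans_le h2)]
      refine sumRightOf_eq_sumLeftOf hD hx he h4 h3.le h2 fun b hb => ?_
      exact absurd (hmax _ ⟨⟨b, rfl⟩, h3.trans hb.1, hb.2⟩) (not_le.2 hb.1)
    · refine sumRightOf_eq_sumLeftOf hD hx he h1 le_rfl h2 fun b hb => hne ⟨(p b).1, ?_⟩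
      simp [hb]

theorem sumBelow_add_eq_sumRightOf [DecidableEq (ℝ × ℝ)] {e : D} (he : IsRight rev p e) :
    sumBelow rev p z e +
      ∑ d, (if p d = p e ∧ dartKey rev p d ≤ dartKey rev p e then z d else 0) =
        sumRightOf rev p z e (p e).1 := by
  classical
  rw [sumBelow, sumRightOf, ← Finset.sum_add_distrib]
  refine Finset.sum_congr rfl fun d _ => ?_
  simp only [dartKey_le_of_isRight he, dartHeight_left (rev := rev) e]
  by_cases hd : IsRight rev p d
  swap
  · simp [hd]
  rcases lt_trichotomy (p d).1 (p e).1 with h | h | h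
  · have hpc : p d ≠ p e := fun h' => h.ne (congrArg Prod.fst h')
    simp only [hd, h.le, h, hpc, true_and, false_and, if_false, add_zero]
    refine if_congr (and_congr_right fun hl => ?_) rfl rfl
    refine ⟨Or.inl, fun h' => h'.resolve_right fun h'' => ?_⟩
    exact dartHeight_ne hD hx hd h hl h''.1.symm
  · have hpc : p d = p e := hx _ _ h
    have hd' := hd
    rw [IsRight, h] at hd'
    have hh := dartHeight_left (rev := rev) (p := p) d
    rw [hpc] at hh
    simp [hd, hpc, hh, hd']
  · have hpc : p d ≠ p e := fun h' => h.ne' (congrArg Prod.fst h')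
    simp [hpc, not_le.2 h, not_lt.2 h.le]

/-- By evenness, the darts at the right end with key at most that of `rev e` may be exchanged for
the remaining ones. Reversed, these are the segments of larger slope ending there, which lie below
`e` just to the left; the term `z e` adds `e` itself. -/
theorem sumBelow_rev_add_eq_sumLeftOf (hz : ∀ d, z (rev d) = z d) [DecidableEq (ℝ × ℝ)]
    (hev : ∀ c, ∑ e, (if p e = p c then z e else 0) = 0) {e : D} (he : IsRight rev p e) :
    sumBelow rev p z (rev e) +
      ∑ d, (if p d = p (rev e) ∧ dartKey rev p d ≤ dartKey rev p (rev e) then z d else 0) + z e =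
        sumLeftOf rev p z e (p (rev e)).1 := by
  classical
  have he' : ¬ IsRight rev p (rev e) := by rw [isRight_rev hD hx]; simpa using he
  have h1 : ∑ d, (if p d = p (rev e) ∧ dartKey rev p d ≤ dartKey rev p (rev e) then z d else 0) =
      ∑ d, if p d = p (rev e) ∧ ¬ IsRight rev p d ∧ dartSlope rev p e < dartSlope rev p d
        then z d else 0 := by
    rw [← sub_eq_zero, CharTwo.sub_eq_add, ← Finset.sum_add_distrib]
    refine (Finset.sum_congr rfl fun d _ => ?_).trans (hev (rev e))
    simp only [dartKey_le_of_not_isRight he', dartSlope_rev hD, ← not_le]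
    by_cases h1 : p d = p (rev e) <;> by_cases h2 : IsRight rev p d <;>
      by_cases h3 : dartSlope rev p d ≤ dartSlope rev p e <;> simp [h1, h2, h3]
  have h2 : ∑ d, (if p d = p (rev e) ∧ ¬ IsRight rev p d ∧ dartSlope rev p e < dartSlope rev p d
      then z d else 0) = ∑ d, if p (rev d) = p (rev e) ∧ IsRight rev p d ∧
        dartSlope rev p e < dartSlope rev p d then z d else 0 := by
    symm
    refine Fintype.sum_equiv (Function.Involutive.toPerm rev hD.rev_rev) _ _ fun d => ?_
    have := isRight_rev hD hx d
    change _ = if p (rev d) = p (rev e) ∧ ¬ IsRight rev p (rev d) ∧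
      dartSlope rev p e < dartSlope rev p (rev d) then z (rev d) else 0
    simp only [this, not_not, hz, dartSlope_rev hD]
  have h3 : z e = ∑ d, if d = e then z d else 0 := by simp
  rw [h1, h2, h3, sumBelow, sumLeftOf, ← Finset.sum_add_distrib, ← Finset.sum_add_distrib]
  refine Finset.sum_congr rfl fun d _ => ?_
  rw [dartHeight_right hD hx e]
  by_cases hd : IsRight rev p d
  swap
  · have : d ≠ e := fun h => hd (h ▸ he)
    simp [hd, this]
  rcases lt_trichotomy (p (rev e)).1 (p (rev d)).1 with h | h | h
  · have hpc : p (rev d) ≠ p (rev e) := fun h' => h.ne' (congrArg Prod.fst h')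
    have hde : d ≠ e := fun h' => hpc (h' ▸ rfl)
    simp only [hd, h.le, h, hpc, hde, true_and, false_and, if_false, add_zero]
    refine if_congr (and_congr_right fun hl => ?_) rfl rfl
    refine ⟨Or.inl, fun h' => h'.resolve_right fun h'' => ?_⟩
    exact dartHeight_ne hD hx hd hl h h''.1.symm
  · have hpc : p (rev d) = p (rev e) := hx _ _ h.symm
    have hd' := hd
    rw [IsRight, ← h] at hd'
    have hh := dartHeight_right hD hx d
    rw [hpc] at hh
    have hde : d = e ↔ dartSlope rev p d = dartSlope rev p e := by
      refine ⟨fun h => h ▸ rfl, fun hs => ?_⟩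
      have hd2 : ¬ IsRight rev p (rev d) := by rw [isRight_rev hD hx]; simpa using hd
      have := dartKey_injective hD hx hpc (by
        simp only [dartKey, hd2, he', if_false, dartSlope_rev hD, hs])
      rw [← hD.rev_rev d, this, hD.rev_rev]
    simp only [hd, hpc, hh, hd', hde, true_and, lt_irrefl, le_refl, false_and, if_false,
      zero_add, false_or]
    rcases lt_trichotomy (dartSlope rev p e) (dartSlope rev p d) with h | h | h
    · simp [h, h.le, h.ne']
    · simp [h]
    · simp [not_le.2 h, not_lt.2 h.le, h.ne]
  · have hpc : p (rev d) ≠ p (rev e) := fun h' => h.ne (congrArg Prod.fst h')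
    have hde : d ≠ e := fun h' => hpc (h' ▸ rfl)
    simp [hpc, hde, not_le.2 h, not_lt.2 h.le]

end Sums

variable [Fintype D]

/-- A rotation system of a straight-line drawing in which every even set of edges is the boundary of
a set of faces; no two points lie over each other. -/
theorem IsStraightDrawing.exists_rotation_of_generic (hD : IsStraightDrawing rev p)
    (hx : ∀ d e, (p d).1 = (p e).1 → p d = p e) [DecidableEq (ℝ × ℝ)] :
    ∃ σ : Equiv.Perm D, (∀ d, p (σ d) = p d) ∧ (∀ d, σ d = d → ∀ e, p e = p d → e = d) ∧
      ∀ z : D → ZMod 2, (∀ d, z (rev d) = z d) →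
        (∀ d, ∑ e, (if p e = p d then z e else 0) = 0) →
        ∃ h : D → ZMod 2, ∀ d, h d + h (σ d) = z (σ d) ∧ h d + h (rev d) = z d := by
  classical
  obtain ⟨σ, hσ1, hσ2, hσ3⟩ := exists_cyclic_successor p (dartKey rev p)
    (fun d e h1 h2 => dartKey_injective hD hx h1 h2)
  -- The value at `c` is the parity of crossings met when coming from far below up to the point `p
  -- c` and then turning counterclockwise past `c`. It tells whether the region on the left of `c`
  -- is inside.
  refine ⟨σ, hσ1, hσ2, fun z hz hev => ⟨fun c => sumBelow rev p z c +
    ∑ d, (if p d = p c ∧ dartKey rev p d ≤ dartKey rev p c then z d else 0), fun d => ⟨?_, ?_⟩⟩⟩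
  · have h1 : sumBelow rev p z (σ d) = sumBelow rev p z d := by rw [sumBelow, sumBelow, hσ1]
    simp only
    rw [h1, hσ1, hσ3 z hev d]
    ring_nf
    simp [CharTwo.two_eq_zero]
  · have key : ∀ d, IsRight rev p d → sumBelow rev p z d +
        ∑ e, (if p e = p d ∧ dartKey rev p e ≤ dartKey rev p d then z e else 0) +
        (sumBelow rev p z (rev d) +
        ∑ e, (if p e = p (rev d) ∧ dartKey rev p e ≤ dartKey rev p (rev d) then z e else 0)) =
          z d := by
      intro d hd
      have h1 := sumBelow_add_eq_sumRightOf (z := z) hD hx hd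
      have h2 := sumBelow_rev_add_eq_sumLeftOf hD hx hz hev hd
      rw [← sumRightOf_eq_sumLeftOf_ends hD hx hz hev hd, ← h1] at h2
      rw [← h2]
      ring_nf
      simp [CharTwo.two_eq_zero]
    simp only
    by_cases hd : IsRight rev p d
    · exact key d hd
    · have := key (rev d) ((isRight_rev hD hx d).2 hd)
      rw [hD.rev_rev, hz] at this
      rw [← this, add_comm]

end StraightLine

/-! ### Removing vertical coincidences by a shear -/

section Shear

/-- Each pair of points with different ordinates rules out a single `t`, and there are finitely many
pairs. -/
theorem exists_shear_injective {D : Type*} [Finite D] (p : D → ℝ × ℝ) :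
    ∃ t : ℝ, ∀ d e, (p d).1 + t * (p d).2 = (p e).1 + t * (p e).2 → p d = p e := by
  classical
  cases nonempty_fintype D
  obtain ⟨t, ht⟩ := Infinite.exists_notMem_finset (Finset.univ.image fun x : D × D =>
    -((p x.1).1 - (p x.2).1) / ((p x.1).2 - (p x.2).2))
  refine ⟨t, fun d e h => ?_⟩
  by_cases h2 : (p d).2 = (p e).2
  · rw [h2] at h
    exact Prod.ext (add_right_cancel h) h2
  · refine absurd (Finset.mem_image.2 ⟨(d, e), Finset.mem_univ _, ?_⟩) ht
    rw [div_eq_iff (sub_ne_zero.2 h2)]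
    linarith

theorem IsStraightDrawing.comp {D : Type*} {rev : D → D} {p : D → ℝ × ℝ}
    (hD : IsStraightDrawing rev p) (f : ℝ × ℝ →ₗ[ℝ] ℝ × ℝ) (hf : Function.Injective f) :
    IsStraightDrawing rev fun d => f (p d) where
  rev_rev := hD.rev_rev
  ne_rev d h := hD.ne_rev d (hf h)
  meet d e h1 h2 x hx hx' := by
    have himage : ∀ a b, segment ℝ (f a) (f b) = f '' segment ℝ a b := fun a b =>
      (image_segment ℝ f.toAffineMap a b).symm
    rw [himage] at hx hx'
    obtain ⟨y, hy, rfl⟩ := hx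
    obtain ⟨y', hy', hyy'⟩ := hx'
    obtain rfl := hf hyy'
    obtain ⟨a, b⟩ := hD.meet d e h1 h2 _ hy hy'
    exact ⟨a.imp (congrArg f) (congrArg f), b.imp (congrArg f) (congrArg f)⟩

theorem IsStraightDrawing.exists_rotation {D : Type*} [Fintype D] {rev : D → D} {p : D → ℝ × ℝ}
    (hD : IsStraightDrawing rev p) [DecidableEq (ℝ × ℝ)] :
    ∃ σ : Equiv.Perm D, (∀ d, p (σ d) = p d) ∧ (∀ d, σ d = d → ∀ e, p e = p d → e = d) ∧
      ∀ z : D → ZMod 2, (∀ d, z (rev d) = z d) →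
        (∀ d, ∑ e, (if p e = p d then z e else 0) = 0) →
        ∃ h : D → ZMod 2, ∀ d, h d + h (σ d) = z (σ d) ∧ h d + h (rev d) = z d := by
  obtain ⟨t, ht⟩ := exists_shear_injective p
  let f : ℝ × ℝ →ₗ[ℝ] ℝ × ℝ :=
    (LinearMap.fst ℝ ℝ ℝ + t • LinearMap.snd ℝ ℝ ℝ).prod (LinearMap.snd ℝ ℝ ℝ)
  have hf : Function.Injective f := by
    intro x y h
    have h1 : (f x).1 = (f y).1 := by rw [h]
    have h2 : (f x).2 = (f y).2 := by rw [h]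
    change x.1 + t * x.2 = y.1 + t * y.2 at h1
    change x.2 = y.2 at h2
    rw [h2] at h1
    exact Prod.ext (add_right_cancel h1) h2
  obtain ⟨σ, h1, h2, h3⟩ := (hD.comp f hf).exists_rotation_of_generic
    (fun d e h => congrArg f (ht d e h))
  refine ⟨σ, fun d => hf (h1 d), fun d hd e he => h2 d hd e (congrArg f he), fun z hz hev =>
    h3 z hz fun d => ?_⟩
  simpa only [hf.eq_iff] using hev d

end Shear

/-! ### Incidences on a polygonal arc -/

section PolygonalArc

variable {m : ℕ} {q : ℕ → ℝ × ℝ}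

theorem polygon_inter (h2 : ∀ i, i + 1 < m →
      segment ℝ (q i) (q (i + 1)) ∩ segment ℝ (q (i + 1)) (q (i + 2)) = {q (i + 1)})
    (h3 : ∀ i j, i + 1 < j → j < m →
      Disjoint (segment ℝ (q i) (q (i + 1))) (segment ℝ (q j) (q (j + 1)))) {i j : ℕ} (hij : i < j)
    (hj : j < m) {x : ℝ × ℝ} (hx : x ∈ segment ℝ (q i) (q (i + 1)))
    (hx' : x ∈ segment ℝ (q j) (q (j + 1))) : j = i + 1 ∧ x = q (i + 1) := by
  rcases Nat.lt_or_ge (i + 1) j with h | h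
  · exact absurd hx' (Set.disjoint_left.1 (h3 i j h hj) hx)
  · obtain rfl : j = i + 1 := by omega
    refine ⟨rfl, ?_⟩
    have : x ∈ segment ℝ (q i) (q (i + 1)) ∩ segment ℝ (q (i + 1)) (q (i + 2)) := ⟨hx, hx'⟩
    rwa [h2 i hj] at this

variable (h2 : ∀ i, i + 1 < m →
      segment ℝ (q i) (q (i + 1)) ∩ segment ℝ (q (i + 1)) (q (i + 2)) = {q (i + 1)})
    (h3 : ∀ i j, i + 1 < j → j < m →
      Disjoint (segment ℝ (q i) (q (i + 1))) (segment ℝ (q j) (q (j + 1))))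

include h2 h3

theorem polygon_interior {i j : ℕ} (hi0 : 0 < i) (hi : i < m) (hj : j < m)
    (h : q i ∈ segment ℝ (q j) (q (j + 1))) : j = i ∨ j + 1 = i := by
  obtain ⟨k, rfl⟩ : ∃ k, i = k + 1 := ⟨i - 1, by omega⟩
  by_contra hcon
  rcases Nat.lt_or_ge (k + 1) j with hlt | hge
  · have := (polygon_inter h2 h3 (show k < j by omega) hj (right_mem_segment _ _ _) h).1
    omega
  · have := (polygon_inter h2 h3 (show j < k + 1 by omega) hi h (left_mem_segment _ _ _)).1
    omega

variable (h1 : ∀ i, i < m → q i ≠ q (i + 1))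

include h1

theorem polygon_first {i : ℕ} (hi : i < m) (h : q 0 ∈ segment ℝ (q i) (q (i + 1))) : i = 0 := by
  by_contra h0
  obtain ⟨-, h'⟩ := polygon_inter h2 h3 (Nat.pos_of_ne_zero h0) hi (left_mem_segment _ _ _) h
  exact h1 0 (by omega) h'

theorem polygon_last {i : ℕ} (hi : i < m) (h : q m ∈ segment ℝ (q i) (q (i + 1))) :
    i + 1 = m := by
  by_contra h0
  obtain ⟨n, rfl⟩ : ∃ n, m = n + 1 := ⟨m - 1, by omega⟩
  obtain ⟨h', h''⟩ := polygon_inter h2 h3 (show i < n by omega) (Nat.lt_succ_self n) h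
    (right_mem_segment _ _ _)
  subst h'
  exact h1 (i + 1) (Nat.lt_succ_self _) h''.symm

end PolygonalArc

/-! ### From polygonal drawings to rotation systems of the graph -/

namespace SimpleGraph

variable {V : Type*} [Fintype V] [DecidableEq V] {G : SimpleGraph V} [DecidableRel G.Adj]

/-- The edge of a dart. -/
def Dart.toEdge (d : G.Dart) : G.edgeSet := ⟨d.edge, d.edge_mem⟩

/-- Every plane drawing yields a rotation system in which every even set of edges is the boundary of
a set of faces. -/
theorem PlaneDrawing.exists_rotation (P : G.PlaneDrawing) :
    ∃ σ : Equiv.Perm G.Dart, (∀ d, (σ d).fst = d.fst) ∧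
      (∀ d, σ d = d → ∀ e : G.Dart, e.fst = d.fst → e = d) ∧
      ∀ z : G.edgeSet → ZMod 2,
        (∀ v, ∑ d : G.Dart, (if d.fst = v then z d.toEdge else 0) = 0) →
        ∃ h : G.Dart → ZMod 2, ∀ d, h d + h (σ d) = z (σ d).toEdge ∧
          h d + h d.symm = z d.toEdge := by
  classical
  have hex : ∀ e : G.edgeSet, ∃ (u v : V) (m : ℕ) (q : ℕ → ℝ × ℝ), e.1 = s(u, v) ∧ G.Adj u v ∧
      0 < m ∧ q 0 = P.pos u ∧ q m = P.pos v ∧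
      (∀ i, i < m → q i ≠ q (i + 1)) ∧
      (∀ i, i + 1 < m →
        segment ℝ (q i) (q (i + 1)) ∩ segment ℝ (q (i + 1)) (q (i + 2)) = {q (i + 1)}) ∧
      (∀ i j, i + 1 < j → j < m →
        Disjoint (segment ℝ (q i) (q (i + 1))) (segment ℝ (q j) (q (j + 1)))) ∧
      ∀ i, i < m → segment ℝ (q i) (q (i + 1)) ⊆ P.arc e := by
    rintro ⟨e, he⟩
    induction e using Sym2.ind with
    | h u v =>
      obtain ⟨m, q, h0, h1, h2, h3, h4, h5, h6⟩ := P.isPolygonalArc u v he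
      refine ⟨u, v, m, q, rfl, he, h0, h1, h2, h3, h4, h5, fun i hi x hx => ?_⟩
      rw [h6]
      exact Set.mem_biUnion (Finset.mem_coe.2 (Finset.mem_range.2 hi)) hx
  choose u v m q huv hadj hm hq0 hqm hq1 hq2 hq3 hqarc using hex
  let D := (Σ e : G.edgeSet, Fin (m e)) × Bool
  let rev : D → D := fun d => (d.1, !d.2)
  let p : D → ℝ × ℝ := fun d => bif d.2 then q d.1.1 (d.1.2 + 1) else q d.1.1 d.1.2
  have hseg : ∀ d : D, segment ℝ (p d) (p (rev d)) =
      segment ℝ (q d.1.1 d.1.2) (q d.1.1 (d.1.2 + 1)) := by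
    rintro ⟨s, _ | _⟩
    · rfl
    · exact segment_symm _ _ _
  have hpseg : ∀ d : D, p d ∈ segment ℝ (q d.1.1 d.1.2) (q d.1.1 (d.1.2 + 1)) := fun d => by
    rw [← hseg]; exact left_mem_segment _ _ _
  -- where the vertices of the graph lie on the arcs
  have hend : ∀ (e : G.edgeSet) (i : ℕ) (_ : i < m e) (w : V),
      P.pos w ∈ segment ℝ (q e i) (q e (i + 1)) → (w = u e ∧ i = 0) ∨ (w = v e ∧ i + 1 = m e) := by
    intro e i hi w hw
    have hwe := P.mem_of_pos_mem_arc e e.2 w (hqarc e i hi hw)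
    rw [huv e, Sym2.mem_iff] at hwe
    rcases hwe with rfl | rfl
    · rw [← hq0] at hw
      exact Or.inl ⟨rfl, polygon_first (hq2 e) (hq3 e) (hq1 e) hi hw⟩
    · rw [← hqm] at hw
      exact Or.inr ⟨rfl, polygon_last (hq2 e) (hq3 e) (hq1 e) hi hw⟩
  have hmeet : ∀ s t : (Σ e : G.edgeSet, Fin (m e)), t ≠ s → ∀ x,
      x ∈ segment ℝ (q s.1 s.2) (q s.1 (s.2 + 1)) → x ∈ segment ℝ (q t.1 t.2) (q t.1 (t.2 + 1)) →
      x = q s.1 s.2 ∨ x = q s.1 (s.2 + 1) := by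
    rintro ⟨e, i⟩ ⟨f, j⟩ hne x hx hx'
    by_cases hef : f = e
    · subst hef
      have hij : (j : ℕ) ≠ i := fun h => hne (by rw [Fin.ext h])
      rcases lt_or_gt_of_ne hij with h | h
      · obtain ⟨h', h''⟩ := polygon_inter (hq2 f) (hq3 f) h i.2 hx' hx
        left
        simp only [h', h'']
      · exact Or.inr (polygon_inter (hq2 f) (hq3 f) h j.2 hx hx').2
    · obtain ⟨w, -, -, rfl⟩ := P.arc_inter_arc e e.2 f f.2 (fun h => hef (Subtype.ext h.symm)) x
        ⟨hqarc e i i.2 hx, hqarc f j j.2 hx'⟩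
      rcases hend e i i.2 w hx with ⟨rfl, h⟩ | ⟨rfl, h⟩
      · left; simp only [h, hq0]
      · right; simp only [h, hqm]
  have hD : IsStraightDrawing rev p := by
    refine ⟨fun d => by simp [rev], ?_, ?_⟩
    · rintro ⟨⟨e, i⟩, _ | _⟩
      · exact hq1 e i i.2
      · exact (hq1 e i i.2).symm
    · rintro ⟨s, a⟩ ⟨t, b⟩ h1 h2 x hx hx'
      have hts : t ≠ s := by
        rintro rfl
        cases a <;> cases b <;> simp [rev] at h1 h2
      rw [hseg] at hx hx'
      have k1 := hmeet s t hts x hx hx'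
      have k2 := hmeet t s hts.symm x hx' hx
      constructor
      · cases a
        · exact k1
        · exact k1.symm
      · cases b
        · exact k2
        · exact k2.symm
  obtain ⟨τ, hτ1, hτ2, hτ3⟩ := hD.exists_rotation
  -- the darts at a vertex of the graph
  let src : G.edgeSet × Bool → V := fun a => bif a.2 then v a.1 else u a.1
  -- An edge leaves `u` by its first segment taken forwards and leaves `v` by its last segment, of
  -- index `m - 1`, taken backwards.
  let ε : G.edgeSet × Bool → D := fun a =>
    (⟨a.1, bif a.2 then ⟨m a.1 - 1, Nat.sub_lt (hm _) one_pos⟩ else ⟨0, hm _⟩⟩, a.2)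
  have hε : Function.Injective ε := by
    rintro ⟨e, a⟩ ⟨f, b⟩ h
    have h1 : e = f := congrArg (fun d : D => d.1.1) h
    have h2 : a = b := congrArg (fun d : D => d.2) h
    rw [h1, h2]
  have hpε : ∀ a, p (ε a) = P.pos (src a) := by
    rintro ⟨e, _ | _⟩
    · exact hq0 e
    · have : m e - 1 + 1 = m e := Nat.sub_add_cancel (hm e)
      simp only [p, ε, src, cond_true, this, hqm]
  have hfib : ∀ (d : D) (w : V), p d = P.pos w → ∃ a, ε a = d ∧ src a = w := by
    rintro ⟨⟨e, i⟩, b⟩ w h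
    have h' := hpseg ⟨⟨e, i⟩, b⟩
    rw [h] at h'
    rcases hend e i i.2 w h' with ⟨rfl, h0⟩ | ⟨rfl, h0⟩
    · cases b
      · refine ⟨(e, false), ?_, rfl⟩
        have : (⟨0, hm e⟩ : Fin (m e)) = i := Fin.ext h0.symm
        simp only [ε, cond_false, this]
      · exfalso
        simp only [p, cond_true, h0, zero_add, ← hq0] at h
        exact hq1 e 0 (hm e) h.symm
    · cases b
      · exfalso
        simp only [p, cond_false, ← hqm, ← h0] at h
        exact hq1 e i i.2 h
      · refine ⟨(e, true), ?_, rfl⟩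
        have : (⟨m e - 1, Nat.sub_lt (hm e) one_pos⟩ : Fin (m e)) = i :=
          Fin.ext (by simp only; omega)
        simp only [ε, cond_true, this]
  -- the darts at a bend
  have hbend : ∀ (e : G.edgeSet) (i : ℕ) (hi : i + 1 < m e) (d : D), p d = q e (i + 1) ↔
      d = (⟨e, ⟨i + 1, hi⟩⟩, false) ∨ d = (⟨e, ⟨i, by omega⟩⟩, true) := by
    rintro e i hi ⟨⟨f, j⟩, b⟩
    constructor
    · intro h
      have h' := hpseg ⟨⟨f, j⟩, b⟩
      rw [h] at h'
      by_cases hef : e = f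
      · subst hef
        rcases polygon_interior (hq2 e) (hq3 e) (Nat.succ_pos i) hi j.2 h' with hj | hj
        · have hj' : j = ⟨i + 1, hi⟩ := Fin.ext hj
          subst hj'
          cases b
          · exact Or.inl rfl
          · exact absurd h.symm (hq1 e (i + 1) hi)
        · have hj' : j = ⟨i, Nat.lt_of_succ_lt hi⟩ := Fin.ext (by simp only; omega)
          subst hj'
          cases b
          · exact absurd h (hq1 e i (by omega))
          · exact Or.inr rfl
      · exfalso
        have hl := left_mem_segment ℝ (q e (i + 1)) (q e (i + 1 + 1))
        have hl' := right_mem_segment ℝ (q e i) (q e (i + 1))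
        obtain ⟨w, -, -, hw⟩ := P.arc_inter_arc e e.2 f f.2 (fun h => hef (Subtype.ext h)) _
          ⟨hqarc e _ hi hl, hqarc f j j.2 h'⟩
        rw [hw] at hl hl'
        rcases hend e (i + 1) hi w (hw ▸ left_mem_segment ℝ _ _) with ⟨-, h0⟩ | ⟨rfl, -⟩
        · omega
        · rcases hend e i (by omega) (v e) (hw ▸ right_mem_segment ℝ _ _) with ⟨h0, -⟩ | ⟨-, h0⟩
          · exact (hadj e).ne h0.symm
          · omega
    · rintro (h | h) <;> rw [h] <;> rfl
  have hτε : ∀ a, ∃ b, ε b = τ (ε a) ∧ src b = src a := fun a =>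
    hfib _ _ ((hτ1 _).trans (hpε a))
  choose s hs1 hs2 using hτε
  have hs : Function.Injective s := fun a b h =>
    hε (τ.injective (by rw [← hs1, ← hs1, h]))
  have hvertex : ∀ (z : G.edgeSet → ZMod 2) (w : V),
      ∑ d : D, (if p d = P.pos w then z d.1.1 else 0) =
        ∑ a, if src a = w then z a.1 else 0 := by
    intro z w
    symm
    refine Fintype.sum_of_injective ε hε _ _ (fun d hd => ?_) (fun a => ?_)
    · rw [if_neg]
      intro h
      obtain ⟨a, ha, -⟩ := hfib d w h
      exact hd ⟨a, ha⟩
    · simp only [hpε, P.pos_injective.eq_iff]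
      rfl
  -- the abstract darts are the darts of the graph
  let δ : G.edgeSet × Bool → G.Dart := fun a =>
    bif a.2 then ⟨(v a.1, u a.1), (hadj a.1).symm⟩ else ⟨(u a.1, v a.1), hadj a.1⟩
  have hδe : ∀ a, (δ a).toEdge = a.1 := by
    rintro ⟨e, _ | _⟩
    · exact Subtype.ext (huv e).symm
    · exact Subtype.ext ((huv e).trans Sym2.eq_swap).symm
  have hδs : ∀ a, (δ a).fst = src a := by rintro ⟨e, _ | _⟩ <;> rfl
  have hδr : ∀ a, (δ a).symm = δ (a.1, !a.2) := by rintro ⟨e, _ | _⟩ <;> rfl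
  have hδ : Function.Bijective δ := by
    constructor
    · rintro ⟨e, a⟩ ⟨f, b⟩ h
      have h1 : e = f := by
        have := congrArg Dart.toEdge h
        rwa [hδe, hδe] at this
      subst h1
      have h2 := congrArg (fun d : G.Dart => d.fst) h
      simp only [hδs] at h2
      cases a <;> cases b
      · rfl
      · exact absurd h2 (hadj e).ne
      · exact absurd h2 (hadj e).ne'
      · rfl
    · intro d
      have hd := huv d.toEdge
      change s(d.fst, d.snd) = _ at hd
      rcases Sym2.eq_iff.1 hd with ⟨h1, h2⟩ | ⟨h1, h2⟩
      · exact ⟨(d.toEdge, false), Dart.ext _ _ (Prod.ext h1.symm h2.symm)⟩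
      · exact ⟨(d.toEdge, true), Dart.ext _ _ (Prod.ext h1.symm h2.symm)⟩
  let Δ : G.edgeSet × Bool ≃ G.Dart := Equiv.ofBijective δ hδ
  let S : Equiv.Perm (G.edgeSet × Bool) := Equiv.ofBijective s hs.bijective_of_finite
  have hσ : ∀ a, (Δ.permCongr S) (δ a) = δ (s a) := by
    intro a
    change Δ (S (Δ.symm (Δ a))) = _
    rw [Equiv.symm_apply_apply]
    rfl
  refine ⟨Δ.permCongr S, fun d => ?_, fun d hd e he => ?_, fun z hz => ?_⟩
  · obtain ⟨a, rfl⟩ := hδ.2 d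
    rw [hσ, hδs, hδs, hs2]
  · obtain ⟨a, rfl⟩ := hδ.2 d
    obtain ⟨b, rfl⟩ := hδ.2 e
    rw [hσ] at hd
    have ha : τ (ε a) = ε a := by rw [← hs1, hδ.1 hd]
    rw [hδs, hδs] at he
    rw [hε (hτ2 _ ha (ε b) (by rw [hpε, hpε, he]))]
  · have hzv : ∀ w, ∑ d : D, (if p d = P.pos w then z d.1.1 else 0) = 0 := by
      intro w
      rw [hvertex]
      refine (Fintype.sum_equiv Δ _ _ fun a => ?_).trans (hz w)
      change _ = if (δ a).fst = w then z (δ a).toEdge else 0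
      rw [hδs, hδe]
    have hzb : ∀ (e : G.edgeSet) (i : ℕ), i + 1 < m e →
        ∑ d : D, (if p d = q e (i + 1) then z d.1.1 else 0) = 0 := by
      intro e i hi
      simp only [hbend e i hi]
      rw [← Finset.sum_filter]
      have : (Finset.univ.filter fun d : D => d = (⟨e, ⟨i + 1, hi⟩⟩, false) ∨
          d = (⟨e, ⟨i, by omega⟩⟩, true)) =
          {(⟨e, ⟨i + 1, hi⟩⟩, false), (⟨e, ⟨i, by omega⟩⟩, true)} := by
        ext; simp
      rw [this, Finset.sum_pair fun h => Bool.false_ne_true (congrArg Prod.snd h)]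
      exact CharTwo.add_self_eq_zero _
    obtain ⟨h, hh⟩ := hτ3 (fun d => z d.1.1) (fun d => rfl) (by
      rintro ⟨⟨e, i⟩, b⟩
      cases b
      · rcases Nat.eq_zero_or_pos (i : ℕ) with hi | hi
        · have : p (⟨e, i⟩, false) = P.pos (u e) := by simp only [p, cond_false, hi, hq0]
          simp only [this]
          exact hzv _
        · obtain ⟨k, hk⟩ : ∃ k, (i : ℕ) = k + 1 := ⟨i - 1, by omega⟩
          have : p (⟨e, i⟩, false) = q e (k + 1) := by simp only [p, cond_false, hk]
          simp only [this]
          exact hzb e k (hk ▸ i.2)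
      · rcases Nat.lt_or_ge (i + 1) (m e) with hi | hi
        · exact hzb e i hi
        · have hi' : (i : ℕ) + 1 = m e := le_antisymm i.2 hi
          have : p (⟨e, i⟩, true) = P.pos (v e) := by simp only [p, cond_true, hi', hqm]
          simp only [this]
          exact hzv _)
    have hchain : ∀ (e : G.edgeSet) (i : ℕ) (hi : i < m e),
        h (⟨e, ⟨i, hi⟩⟩, false) = h (⟨e, ⟨0, hm e⟩⟩, false) := by
      intro e i
      induction i with
      | zero => exact fun _ => rfl
      | succ i ih =>
        intro hi
        rw [← ih (by omega)]
        -- A bend carries just two darts, and a fixed point of `τ` would be alone at its point. So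
        -- `τ` exchanges them, and `h` is the same along one side of the whole arc.
        have hswap : τ (⟨e, ⟨i, by omega⟩⟩, true) = (⟨e, ⟨i + 1, hi⟩⟩, false) := by
          rcases (hbend e i hi _).1 (hτ1 (⟨e, ⟨i, by omega⟩⟩, true)) with h' | h'
          · exact h'
          · have := hτ2 _ h' (⟨e, ⟨i + 1, hi⟩⟩, false) rfl
            exact absurd (congrArg Prod.snd this) Bool.false_ne_true
        have e1 := (hh (⟨e, ⟨i, by omega⟩⟩, true)).1
        have e2 := (hh (⟨e, ⟨i, by omega⟩⟩, true)).2
        rw [hswap] at e1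
        exact add_left_cancel (e1.trans e2.symm)
    have hsum : ∀ e, h (ε (e, false)) + h (ε (e, true)) = z e := by
      intro e
      have e1 := hchain e (m e - 1) (Nat.sub_lt (hm _) one_pos)
      have e2 := (hh (⟨e, ⟨m e - 1, Nat.sub_lt (hm _) one_pos⟩⟩, false)).2
      rw [e1] at e2
      exact e2
    refine ⟨fun d => h (ε (Δ.symm d)), fun d => ?_⟩
    obtain ⟨a, rfl⟩ := hδ.2 d
    have hΔ : ∀ b, Δ.symm (δ b) = b := fun b => Δ.symm_apply_apply b
    simp only [hσ, hδr, hδe, hΔ]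
    constructor
    · rw [hs1]
      have := (hh (ε a)).1
      rw [this, ← hs1]
    · obtain ⟨e, _ | _⟩ := a
      · exact hsum e
      · rw [add_comm]; exact hsum e

end SimpleGraph

/-! ### Euler's inequality over the field with two elements -/

namespace SimpleGraph

section Planar

variable {V : Type*} [Fintype V] [DecidableEq V] {G : SimpleGraph V} [DecidableRel G.Adj]

/-- Euler's inequality for a plane drawing: the orbits of the face permutation are the faces. -/
theorem IsPlanar.exists_face_permutation (hG : G.IsPlanar) [Nonempty G.Dart] :
    ∃ φ : Equiv.Perm G.Dart, (∀ d, (φ d).fst = d.snd) ∧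
      (∀ d, φ d = d.symm → G.degree d.snd ≤ 1) ∧
      G.edgeFinset.card + 1 ≤
        Fintype.card V + Nat.card (Quotient (Equiv.Perm.SameCycle.setoid φ)) := by
  classical
  obtain ⟨P⟩ := hG
  obtain ⟨σ, h1, h2, h3⟩ := P.exists_rotation
  have hσ : ∀ d, (σ.symm d).fst = d.fst := fun d => by rw [← h1, Equiv.apply_symm_apply]
  -- With this choice `h (φ d)` and `h d` both equal `z d.toEdge + h d.symm`, so `h` is constant on
  -- the orbits of `φ`.
  let φ : Equiv.Perm G.Dart := (Function.Involutive.toPerm _ Dart.symm_involutive).trans σ.symm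
  have hφ : ∀ d, φ d = σ.symm d.symm := fun d => rfl
  refine ⟨φ, fun d => by rw [hφ, hσ]; rfl, fun d hd => ?_, ?_⟩
  · rw [hφ, Equiv.symm_apply_eq] at hd
    have := h2 d.symm hd.symm
    rw [← G.dart_fst_fiber_card_eq_degree, Finset.card_le_one]
    intro a ha b hb
    simp only [Finset.mem_filter, Finset.mem_univ, true_and] at ha hb
    rw [this a ha, this b hb]
  · let bd : (G.edgeSet → ZMod 2) →ₗ[ZMod 2] (V → ZMod 2) :=
      { toFun := fun z v => ∑ d : G.Dart, if d.fst = v then z d.toEdge else 0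
        map_add' := fun z z' => by
          ext v
          simp only [Pi.add_apply, ← Finset.sum_add_distrib]
          exact Finset.sum_congr rfl fun d _ => by split_ifs <;> simp
        map_smul' := fun c z => by
          ext v
          simp [Finset.mul_sum] }
    have hker : ∀ z : LinearMap.ker bd, ∃ h : G.Dart → ZMod 2, (∀ d, h (φ d) = h d) ∧
        ∀ d, h d + h d.symm = z.1 d.toEdge := by
      rintro ⟨z, hz⟩
      obtain ⟨h, hh⟩ := h3 z fun v => congrFun hz v
      refine ⟨h, fun d => ?_, fun d => (hh d).2⟩
      have e1 := (hh (φ d)).1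
      rw [hφ, Equiv.apply_symm_apply] at e1
      have e2 := (hh d).2
      have e3 : d.symm.toEdge = d.toEdge := Subtype.ext d.edge_symm
      rw [e3, ← e2] at e1
      exact add_right_cancel e1
    choose h hφh hh using hker
    have hcyc : ∀ z (d e : G.Dart), φ.SameCycle d e → h z d = h z e := by
      intro z d e hde
      obtain ⟨i, -, rfl⟩ := hde.exists_pow_eq'
      induction i with
      | zero => rfl
      | succ i ih =>
        rw [pow_succ', Equiv.Perm.mul_apply, hφh]
        exact ih ⟨i, by simp⟩
    -- `h` need not depend linearly on `z`; injectivity suffices for counting. The sums over a dart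
    -- and its reverse recover `z`, and then any dart recovers the constant.
    let Ψ : LinearMap.ker bd × ZMod 2 → (Quotient (Equiv.Perm.SameCycle.setoid φ) → ZMod 2) :=
      fun x => Quotient.lift (fun d => h x.1 d + x.2) fun d e hde => by
        rw [hcyc x.1 d e hde]
    have hΨ : Function.Injective Ψ := by
      rintro ⟨z, c⟩ ⟨z', c'⟩ heq
      have hd : ∀ d, h z d + c = h z' d + c' := fun d => congrFun heq (Quotient.mk _ d)
      have hz : z = z' := by
        apply Subtype.ext
        ext ⟨e, he⟩
        induction e using Sym2.ind with
        | h u v =>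
          have e1 := hd ⟨(u, v), he⟩
          have e2 := hd (Dart.symm ⟨(u, v), he⟩)
          have e3 := hh z ⟨(u, v), he⟩
          have e4 := hh z' ⟨(u, v), he⟩
          change _ = z.1 ⟨s(u, v), he⟩ at e3
          change _ = z'.1 ⟨s(u, v), he⟩ at e4
          have e5 : h z ⟨(u, v), he⟩ = h z' ⟨(u, v), he⟩ + (c' + c) := by
            rw [← add_assoc, ← e1, add_assoc, CharTwo.add_self_eq_zero, add_zero]
          have e6 : h z (Dart.symm ⟨(u, v), he⟩) = h z' (Dart.symm ⟨(u, v), he⟩) + (c' + c) := by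
            rw [← add_assoc, ← e2, add_assoc, CharTwo.add_self_eq_zero, add_zero]
          rw [← e3, ← e4, e5, e6, add_add_add_comm, CharTwo.add_self_eq_zero, add_zero]
      subst hz
      obtain ⟨d⟩ := ‹Nonempty G.Dart›
      rw [add_left_cancel (hd d)]
    have hcard := Nat.card_le_card_of_injective Ψ hΨ
    rw [Nat.card_prod, Module.natCard_eq_pow_finrank (K := ZMod 2), Nat.card_fun, Nat.card_zmod,
      ← pow_succ, Nat.pow_le_pow_iff_right (by norm_num)] at hcard
    have hrank := bd.finrank_range_add_finrank_ker
    have hle := Submodule.finrank_le (LinearMap.range bd)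
    rw [Module.finrank_fintype_fun_eq_card] at hrank hle
    rw [← G.edgeFinset_card] at hrank
    omega

end Planar

/-! ### Induced subgraphs, walks and the conclusion -/

section Main

variable {V : Type*} {G : SimpleGraph V}

theorem IsPlanar.induce (hG : G.IsPlanar) (X : Set V) : (G.induce X).IsPlanar := by
  obtain ⟨P⟩ := hG
  refine ⟨⟨fun v => P.pos v, fun e => P.arc (e.map Subtype.val), fun u v h =>
    Subtype.ext (P.pos_injective h), fun u v h => P.isPolygonalArc u v h, ?_, ?_⟩⟩
  · intro e he w hw
    induction e using Sym2.ind with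
    | h a b =>
      have := P.mem_of_pos_mem_arc s(↑a, ↑b) he w hw
      simpa [Subtype.ext_iff] using this
  · intro e he f hf hef x hx
    have he' : e.map Subtype.val ∈ G.edgeSet := by
      induction e using Sym2.ind with
      | h a b => exact he
    have hf' : f.map Subtype.val ∈ G.edgeSet := by
      induction f using Sym2.ind with
      | h a b => exact hf
    obtain ⟨v, hve, hvf, rfl⟩ := P.arc_inter_arc _ he' _ hf'
      (fun h => hef (Sym2.map.injective Subtype.val_injective h)) x hx
    rw [Sym2.mem_map] at hve hvf
    obtain ⟨a, ha, rfl⟩ := hve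
    obtain ⟨b, hb, hab⟩ := hvf
    obtain rfl := Subtype.ext hab
    exact ⟨b, ha, hb, rfl⟩

theorem IsPlanar.reducible [Fintype V] [Nonempty V] (hG : G.IsPlanar) (hg : 6 ≤ G.egirth) :
    G.Reducible Finset.univ := by
  classical
  -- Without edges there are no orbits, so the orbit count does not apply; any vertex then has
  -- degree `0` and is itself a root.
  by_cases h : Nonempty G.Dart
  · obtain ⟨φ, h1, h2, h3⟩ := hG.exists_face_permutation
    obtain ⟨x, hx⟩ := exists_degree_le_lowerNeighbours hg φ h1 h2 h3
    exact reducible_of_degree_le hx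
  · obtain ⟨x⟩ := ‹Nonempty V›
    refine reducible_of_degree_le (x := x) ?_
    have : G.degree x = 0 := by
      rw [← G.dart_fst_fiber_card_eq_degree, Finset.card_eq_zero, Finset.filter_eq_empty_iff]
      exact fun d => (h ⟨d⟩).elim
    omega

theorem IsPlanar.reducible_of_nonempty (hG : G.IsPlanar) (hg : 6 ≤ G.egirth) (X : Finset V)
    (hX : X.Nonempty) : G.Reducible X := by
  apply Reducible.of_induce
  have : Nonempty (X : Set V) := hX.coe_sort
  exact (hG.induce _).reducible
    (hg.trans (IsContained.egirth_le ⟨(Embedding.induce (X : Set V)).toCopy⟩))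

/-- The colouring given by a function that is proper on all vertices. -/
def ProperOn.coloring [Fintype V] {k : ℕ} {f : V → Fin k} (hf : G.ProperOn Finset.univ f) :
    G.Coloring (Fin k) :=
  Coloring.mk f fun {u v} h => hf u (Finset.mem_univ _) v (Finset.mem_univ _) h

/-- A listed step may give a vertex the colour it already has. Such a step is no edge of the
recolouring graph and is dropped, hence an inequality of counts. -/
theorem Recolours.exists_walk [Fintype V] [DecidableEq V] {k : ℕ} {f g : V → Fin k}
    {L : List (V × Fin k)} (h : G.Recolours Finset.univ f L g) :
    ∃ w : (G.recolouringGraph k).Walk h.properOn_left.coloring h.properOn_right.coloring,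
      ∀ v, recolourCount w v ≤ stepCount v L := by
  induction h with
  | nil f hf => exact ⟨.nil, fun v => by simp [recolourCount]⟩
  | cons f v c L g hf hv h ih =>
    obtain ⟨w, hw⟩ := ih
    by_cases hc : c = f v
    · subst hc
      have hcol : hf.coloring = h.properOn_left.coloring := by
        ext u
        change _ = ((Function.update f v (f v) u : Fin k) : ℕ)
        rw [Function.update_eq_self]
        rfl
      have key : ∀ {α : G.Coloring (Fin k)} (h' : α = h.properOn_left.coloring),
          ∃ w' : (G.recolouringGraph k).Walk α h.properOn_right.coloring,
            ∀ u, recolourCount w' u = recolourCount w u := by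
        rintro α rfl
        exact ⟨w, fun _ => rfl⟩
      obtain ⟨w', hw'⟩ := key hcol
      refine ⟨w', fun u => ?_⟩
      rw [hw']
      refine (hw u).trans ?_
      simp [stepCount, List.countP_cons]
    · have hadj : (G.recolouringGraph k).Adj hf.coloring h.properOn_left.coloring := by
        refine ⟨v, ?_, fun u hu => ?_⟩
        · change f v ≠ Function.update f v c v
          rw [Function.update_self]
          exact Ne.symm hc
        · by_contra huv
          apply hu
          change f u = Function.update f v c u
          rw [Function.update_of_ne huv]
      refine ⟨.cons hadj w, fun u => ?_⟩
      have hdart : (f u ≠ Function.update f v c u) ↔ v = u := by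
        by_cases huv : u = v
        · subst huv
          simp [Ne.symm hc]
        · simp [huv, Ne.symm huv]
      have hwu := hw u
      rw [recolourCount, stepCount] at hwu ⊢
      rw [Walk.darts_cons, List.countP_cons, List.countP_cons]
      refine Nat.add_le_add hwu (le_of_eq ?_)
      simp only [decide_eq_true_eq]
      exact if_congr hdart rfl rfl

theorem length_eq_sum_recolourCount [Fintype V] {k : ℕ} {α β : G.Coloring (Fin k)}
    (w : (G.recolouringGraph k).Walk α β) : w.length = ∑ v, recolourCount w v := by
  classical
  induction w with
  | nil => simp [recolourCount]
  | @cons α γ β h w ih =>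
    have hex : ∃! v, α v ≠ γ v := h
    obtain ⟨x, hx, hx'⟩ := hex
    simp only [recolourCount, Walk.darts_cons, List.countP_cons, Finset.sum_add_distrib] at ih ⊢
    rw [Walk.length_cons, ih]
    congr 1
    rw [Finset.sum_eq_single x]
    · simp [hx]
    · intro u _ hu
      have : α u = γ u := by
        by_contra hne
        exact hu (hx' u hne)
      simp [this]
    · simp

end Main

end SimpleGraph

theorem mainTheorem2 {V : Type*} [Fintype V] (G : SimpleGraph V)
    (hplanar : G.IsPlanar) (hgirth : 6 ≤ G.egirth) :
    (G.recolouringGraph 5).Connected ∧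
    (G.recolouringGraph 5).ediam ≤ 6143 * (Fintype.card V : ℕ∞) ∧
    ∀ α β : G.Coloring (Fin 5), ∃ w : (G.recolouringGraph 5).Walk α β,
      ∀ v : V, SimpleGraph.recolourCount w v ≤ 6143 := by
  classical
  obtain ⟨⟨f, hf⟩, hrec⟩ := SimpleGraph.recolourableOn_of_reducible
    (hplanar.reducible_of_nonempty hgirth) Finset.univ
  have hwalk : ∀ α β : G.Coloring (Fin 5), ∃ w : (G.recolouringGraph 5).Walk α β,
      ∀ v : V, SimpleGraph.recolourCount w v ≤ 6143 := by
    intro α β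
    have hα : G.ProperOn Finset.univ α := fun u _ v _ huv => α.valid huv
    have hβ : G.ProperOn Finset.univ β := fun u _ v _ huv => β.valid huv
    obtain ⟨L, g, h1, h2, h3⟩ := hrec α β hα hβ
    obtain rfl : g = β := funext fun v => h2 v (Finset.mem_univ v)
    obtain ⟨w, hw⟩ := h1.exists_walk
    exact ⟨w, fun v => (hw v).trans (h3 v (Finset.mem_univ v))⟩
  refine ⟨?_, ?_, hwalk⟩
  · have : Nonempty (G.Coloring (Fin 5)) := ⟨hf.coloring⟩
    exact ⟨fun α β => ⟨(hwalk α β).choose⟩⟩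
  · refine SimpleGraph.ediam_le_of_edist_le fun α β => ?_
    obtain ⟨w, hw⟩ := hwalk α β
    refine (SimpleGraph.edist_le w).trans ?_
    have : w.length ≤ 6143 * Fintype.card V := by
      rw [SimpleGraph.length_eq_sum_recolourCount, mul_comm]
      exact Finset.sum_le_card_nsmul _ _ _ fun v _ => hw v
    exact_mod_cast this
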